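/- **Patterns.** A permutation pattern $p$ of length $m\ge 1$ is a permutation $p_1\cdots p_m$ in which some pairs of consecutive entries are connected by an underline. It occurs in a permutation $\pi$ at positions $i_1<\dots<i_m$ if $\pi_{i_1}\cdots\pi_{i_m}$ is order isomorphic to $p$ and $i_{j+1}=i_j+1$ whenever $p_j,p_{j+1}$ are connected by an underline; $p(\pi)$ is the number of occurrences. The empty pattern $\emptyset$ is also allowed, with the convention that it never occurs. For a set $A$ of patterns and a pattern $p$ put $$F^{A,p}(t,z)=1+\sum_{n\ge1}\frac{t^n}{n!}\sum_{\pi} z^{p(\pi)},$$ where $\pi$ runs over the permutations of length $n$ in which no pattern of $A$ occurs. **$k$-Stirling permutations.** Let $k\ge1$. A $k$-Stirling permutation of order $n$ is a rearrangement $\sigma$ of the multiset $\{1^k,\dots,n^k\}$ such that every element between two consecutive occurrences of $i$ is greater than $i$, for each $i$. The block $[i,i]_\sigma$ is the segment of $\sigma$ from the first to the last occurrence of $i$, and $(i,i)_\sigma$ is $[i,i]_\sigma$ with all $i$'s removed. A block is of level 1 if it is contained in no other block. For $\ell\ge2$, $[i,i]_\sigma$ is of level $\ell$ if it is contained in a level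 $\ell-1$ block $[h,h]_\sigma$, $h\neq i$ (its parent), and is a level 1 block of the word $(h,h)_\sigma$; it is of type $s\in\{1,\dots,k-1\}$ if it lies between the $s$th and the $(s+1)$st occurrences of $h$. Two blocks are siblings if both are of level 1, or if they have the same parent and the same type. A pattern $p$ of length $m\ge 1$ occurs as a block pattern in $\sigma$ at siblings $[b_1,b_1]_\sigma,\dots,[b_m,b_m]_\sigma$, appearing from left to right, if $b_1\cdots b_m$ is order isomorphic to $p$ and the last $b_j$ is immediately followed by the first $b_{j+1}$ whenever $p_j,p_{j+1}$ are connected by an underline. Let $p^{(1)}(\sigma)$ and $p^{(\ell,s)}(\sigma)$ be the numbers of such occurrences at level 1, respectively at level $\ell\ge2$ and type $s$, and let $\mathrm{bl}^{(1)}(\sigma)$, $\mathrm{bl}^{(\ell,s)}(\sigma)$ be the corresponding numbers of blocks. **Generating function.** Let $\tilde A=(A_1,(A_{2,1},\dots,A_{2,k-1}),(A_{3,1},\dots,A_{3,k-1}),\dots)$ consist of sets of patterns, let $\tilde p$ be a sequence of the same shape consisting of patterns, and let $\tilde x,\tilde y$ be sequences of the same shape consisting of variables (or of elements of a commutative $\mathbb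 Q$-algebra). Put $$G_k^{\tilde A,\tilde p}(t;\tilde x;\tilde y)=1+\sum_{n\ge1}\frac{t^n}{n!}\sum_{\sigma}x_1^{p_1^{(1)}(\sigma)}y_1^{\mathrm{bl}^{(1)}(\sigma)}\prod_{i\ge2}\prod_{j=1}^{k-1}x_{i,j}^{p_{i,j}^{(i,j)}(\sigma)}y_{i,j}^{\mathrm{bl}^{(i,j)}(\sigma)},$$ where $\sigma$ runs over the $k$-Stirling permutations of order $n$ in which no pattern of $A_1$ occurs at level 1 and no pattern of $A_{i,j}$ occurs at level $i$ and type $j$. For a sequence $\tilde s$ of the above shape let $\mathrm{sh}_j\tilde s=(s_{2,j},(s_{3,1},\dots,s_{3,k-1}),(s_{4,1},\dots,s_{4,k-1}),\dots)$. **Theorem.** As formal power series in $t$, $$G_k^{\tilde A,\tilde p}(t;\tilde x;\tilde y)=F^{A_1,p_1}\Bigl(y_1\int_0^t\prod_{j=1}^{k-1}G_k^{\mathrm{sh}_j\tilde A,\,\mathrm{sh}_j\tilde p}(u;\mathrm{sh}_j\tilde x;\mathrm{sh}_j\tilde y)\,du,\;x_1\Bigr).$$ For $k=2$ this reduces to the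 following statement on Stirling permutations. Let $A,p,x,y$ be sequences (of sets of patterns, of patterns, of variables and of variables). Call two blocks of a 2-Stirling permutation siblings if both are of level 1 or they have the same parent, and let $p^{(i)}(\sigma)$ and $\mathrm{bl}^{(i)}(\sigma)$ be the numbers of occurrences of $p$ as a block pattern at level $i$ and of blocks of level $i$. Let $$G^{A,p}(t;x;y)=1+\sum_{n\ge1}\frac{t^n}{n!}\sum_\sigma\prod_{i\ge1}x_i^{p_i^{(i)}(\sigma)}y_i^{\mathrm{bl}^{(i)}(\sigma)},$$ where $\sigma$ runs over the 2-Stirling permutations of order $n$ in which no pattern of $A_i$ occurs at level $i$, for all $i\ge 1$. Then $G^{A,p}(t;x;y)$ equals $G_2$ of the same sequences, their terms of index $\ge2$ being read as 1-tuples, and $$G^{A,p}(t;x;y)=F^{A_1,p_1}\Bigl(y_1\int_0^tG^{\mathrm{sh}A,\,\mathrm{sh}p}(u;\mathrm{sh}\,x;\mathrm{sh}\,y)\,du,\;x_1\Bigr),\qquad \mathrm{sh}(s_1,s_2,\dots)=(s_2,s_3,\dots).$$ -/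

import Mathlib

open scoped PowerSeries

/-! ### Permutation patterns -/

/-- A permutation pattern: a permutation `perm` of length `len`, some of whose consecutive entries
are underlined. `j ∈ underline` says that the entries with (zero-based) indices `j` and `j + 1`
are connected by an underline. The case `len = 0` is the empty pattern `∅`, which is used as a
placeholder for "no pattern": it never occurs in anything. -/
structure PermPattern where
  len : ℕ
  perm : Equiv.Perm (Fin len)
  underline : Set (Fin (len - 1))

namespace PermPattern

/-- `b` is order isomorphic to `p`, i.e. the reduced form of `b` is `p` without its underlines. -/
def OrderIso (p : PermPattern) (b : Fin p.len → ℕ) : Prop :=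
  ∀ a c : Fin p.len, b a < b c ↔ p.perm a < p.perm c

/-- The entries of `p` with indices `a` and `c` are adjacent, `a` before `c`, and connected by an
underline. -/
def Linked (p : PermPattern) (a c : Fin p.len) : Prop :=
  ∃ j ∈ p.underline, (a : ℕ) = j ∧ (c : ℕ) = j + 1

/-- `i` lists the (increasing) positions of an occurrence of `p` in the word `w` of length `n`. -/
def IsOcc (p : PermPattern) {n : ℕ} (w : Fin n → ℕ) (i : Fin p.len → Fin n) : Prop :=
  0 < p.len ∧ StrictMono i ∧ p.OrderIso (fun a => w (i a)) ∧
    ∀ a c, p.Linked a c → (i c : ℕ) = (i a : ℕ) + 1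

/-- The number `p(π)` of occurrences of `p` in the permutation `π`. -/
noncomputable def occ (p : PermPattern) {n : ℕ} (π : Equiv.Perm (Fin n)) : ℕ :=
  {i : Fin p.len → Fin n | p.IsOcc (fun a => (π a : ℕ)) i}.ncard

end PermPattern

open Classical in
/-- The permutations of length `n` that avoid all the patterns of `A`. -/
noncomputable def avoidingPerms (A : Set PermPattern) (n : ℕ) : Finset (Equiv.Perm (Fin n)) :=
  {π | ∀ a ∈ A, a.occ π = 0}

/-- The exponential generating function
`F^{A,p}(t, z) = 1 + ∑_{n ≥ 1} (t^n / n!) ∑_π z^{p(π)}`, the inner sum being over the permutations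
`π` of length `n` that avoid `A`, as a power series in `t`. -/
noncomputable def permEGF {R : Type*} [CommRing R] [Algebra ℚ R]
    (A : Set PermPattern) (p : PermPattern) (z : R) : R⟦X⟧ :=
  PowerSeries.mk fun n =>
    if n = 0 then 1
    else algebraMap ℚ R (1 / (n.factorial : ℚ)) * ∑ π ∈ avoidingPerms A n, z ^ p.occ π

/-! ### `k`-Stirling permutations and their blocks -/

/-- The word `1 ⋯ 1 2 ⋯ 2 ⋯ n ⋯ n` in which each of `1, …, n` is repeated `k` times. -/
def sortedWord (k n : ℕ) : List ℕ :=
  (List.range n).flatMap fun i => List.replicate k (i + 1)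

/-- Every element between two consecutive occurrences of a letter `i` is greater than `i`. -/
def IsStirlingWord (σ : List ℕ) : Prop :=
  ∀ a c : Fin σ.length, a < c → σ[a] = σ[c] →
    (∀ b : Fin σ.length, a < b → b < c → σ[b] ≠ σ[a]) →
    ∀ b : Fin σ.length, a < b → b < c → σ[a] < σ[b]

open Classical in
/-- The set `𝒬_{n,k}` of `k`-Stirling permutations of order `n`. -/
noncomputable def kStirling (k n : ℕ) : Finset (List ℕ) :=
  {σ ∈ (sortedWord k n).permutations.toFinset | IsStirlingWord σ}

/-- `[i,i]_σ`: the consecutive segment of `σ` from the first to the last occurrence of `i`. -/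
def block (σ : List ℕ) (i : ℕ) : List ℕ :=
  (σ.dropWhile (· ≠ i)).rdropWhile (· ≠ i)

/-- `(i,i)_σ`: the word `[i,i]_σ` with all occurrences of `i` removed. -/
def blockInterior (σ : List ℕ) (i : ℕ) : List ℕ :=
  (block σ i).filter (· ≠ i)

/-- `[i,i]_σ ⊂ [j,j]_σ`, for letters `i ≠ j` of `σ`. -/
def BlockSub (σ : List ℕ) (i j : ℕ) : Prop :=
  i ∈ σ ∧ i ≠ j ∧ block σ i <:+: block σ j

/-- `[i,i]_σ` is a level 1 block of `σ`: it is contained in no other block. -/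
def IsLevelOne (σ : List ℕ) (i : ℕ) : Prop :=
  i ∈ σ ∧ ∀ j ∈ σ, ¬ BlockSub σ i j

/-- `IsLevel σ ℓ i`: `[i,i]_σ` is a level `ℓ` block of `σ`. For `ℓ ≥ 2` this means that it lies in
a level `ℓ - 1` block `[j,j]_σ` and is a level 1 block of the word `(j,j)_σ`. (Replacing that word
by its reduced form changes nothing, as only containment of blocks matters.) -/
def IsLevel (σ : List ℕ) : ℕ → ℕ → Prop
  | 0, _ => False
  | 1, i => IsLevelOne σ i
  | ℓ + 2, i => ∃ j ∈ σ, IsLevel σ (ℓ + 1) j ∧ BlockSub σ i j ∧ IsLevelOne (blockInterior σ j) i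

/-- `[h,h]_σ` is the parent of `[i,i]_σ`. -/
def IsParent (σ : List ℕ) (h i : ℕ) : Prop :=
  BlockSub σ i h ∧ ∃ ℓ, IsLevel σ ℓ h ∧ IsLevel σ (ℓ + 1) i

/-- `[i,i]_σ` is of type `s`: it lies between the `s`th and the `(s+1)`st occurrences of `h`, where
`[h,h]_σ` is its parent; that is, exactly `s` occurrences of `h` precede the first `i`. -/
def HasType (σ : List ℕ) (i s : ℕ) : Prop :=
  ∃ h, IsParent σ h i ∧ (σ.takeWhile (· ≠ i)).count h = s

/-- Siblings among the blocks of a Stirling permutation: two level 1 blocks, or two blocks with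
the same parent. -/
def Sibling (σ : List ℕ) (i j : ℕ) : Prop :=
  (IsLevel σ 1 i ∧ IsLevel σ 1 j) ∨ ∃ h, IsParent σ h i ∧ IsParent σ h j

/-- Siblings among the blocks of a `k`-Stirling permutation: two level 1 blocks, or two blocks with
the same parent and of the same type. -/
def KSibling (σ : List ℕ) (i j : ℕ) : Prop :=
  (IsLevel σ 1 i ∧ IsLevel σ 1 j) ∨
    ((∃ h, IsParent σ h i ∧ IsParent σ h j) ∧ ∃ s, HasType σ i s ∧ HasType σ j s)

/-- The blocks of the letters `b` form an occurrence of the block pattern `p` in `σ`, with respect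
to the sibling relation `sib`: they are siblings, appear from left to right, their letters are
order isomorphic to `p`, and for underlined neighbours the first occurrence of the later letter
is immediately after the last occurrence of the earlier one (the block `[i,i]_σ` occupies the
`(block σ i).length` positions from `σ.idxOf i` on). -/
def IsBlockOcc (sib : ℕ → ℕ → Prop) (σ : List ℕ) (p : PermPattern) (b : Fin p.len → ℕ) : Prop :=
  0 < p.len ∧ (∀ a, b a ∈ σ) ∧ (∀ a c, sib (b a) (b c)) ∧
    StrictMono (fun a => σ.idxOf (b a)) ∧ p.OrderIso b ∧
    ∀ a c, p.Linked a c → σ.idxOf (b c) = σ.idxOf (b a) + (block σ (b a)).length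

/-! ### Sequences of tuples -/

/-- A sequence `s_1, (s_{2,1}, …, s_{2,k-1}), (s_{3,1}, …, s_{3,k-1}), …`. Indices are zero-based:
`head` is `s_1` and `tail i j` is `s_{i+2,j+1}`. -/
structure TupleSeq (k : ℕ) (α : Type*) where
  head : α
  tail : ℕ → Fin (k - 1) → α

/-- `sh_j s = s_{2,j}, (s_{3,1}, …, s_{3,k-1}), …` -/
def TupleSeq.shift {k : ℕ} {α : Type*} (j : Fin (k - 1)) (s : TupleSeq k α) : TupleSeq k α where
  head := s.tail 0 j
  tail i := s.tail (i + 1)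

/-- A sequence `s_1, s_2, …` (here `s 0, s 1, …`) as a sequence of 1-tuples, for `k = 2`. -/
def TupleSeq.ofSeq {α : Type*} (s : ℕ → α) : TupleSeq 2 α where
  head := s 0
  tail i _ := s (i + 1)

/-! ### The generating function for `k`-Stirling permutations -/

/-- `p^{(1)}(σ)`: the number of occurrences of the block pattern `p` at level 1. -/
noncomputable def kOccOne (σ : List ℕ) (p : PermPattern) : ℕ :=
  {b : Fin p.len → ℕ | IsBlockOcc (KSibling σ) σ p b ∧ ∀ a, IsLevel σ 1 (b a)}.ncard

/-- `p^{(ℓ,s)}(σ)`: the number of occurrences of the block pattern `p` at level `ℓ`, type `s`. -/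
noncomputable def kOcc (σ : List ℕ) (ℓ s : ℕ) (p : PermPattern) : ℕ :=
  {b : Fin p.len → ℕ | IsBlockOcc (KSibling σ) σ p b ∧
    ∀ a, IsLevel σ ℓ (b a) ∧ HasType σ (b a) s}.ncard

/-- `bl^{(ℓ)}(σ)`: the number of level `ℓ` blocks. -/
noncomputable def numBlocks (σ : List ℕ) (ℓ : ℕ) : ℕ :=
  {i : ℕ | IsLevel σ ℓ i}.ncard

/-- `bl^{(ℓ,s)}(σ)`: the number of level `ℓ` blocks of type `s`. -/
noncomputable def numBlocksOfType (σ : List ℕ) (ℓ s : ℕ) : ℕ :=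
  {i : ℕ | IsLevel σ ℓ i ∧ HasType σ i s}.ncard

open Classical in
/-- `𝒬_{n,k}(A)`: the `k`-Stirling permutations of order `n` that avoid the patterns of `A_1` at
level 1 and those of `A_{i,j}` among the blocks of level `i` and type `j`. -/
noncomputable def kStirlingAvoiding (k n : ℕ) (A : TupleSeq k (Set PermPattern)) :
    Finset (List ℕ) :=
  {σ ∈ kStirling k n | (∀ a ∈ A.head, kOccOne σ a = 0) ∧
    ∀ (i : ℕ) (j : Fin (k - 1)), ∀ a ∈ A.tail i j, kOcc σ (i + 2) (j + 1) a = 0}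

/-- The weight `x_1^{p_1^{(1)}(σ)} y_1^{bl^{(1)}(σ)} ∏_{i ≥ 2} ∏_{j=1}^{k-1}
x_{i,j}^{p_{i,j}^{(i,j)}(σ)} y_{i,j}^{bl^{(i,j)}(σ)}`. Only finitely many factors differ from 1,
since `σ` has finitely many blocks. -/
noncomputable def kWeight {R : Type*} [CommRing R] (k : ℕ) (p : TupleSeq k PermPattern)
    (x y : TupleSeq k R) (σ : List ℕ) : R :=
  x.head ^ kOccOne σ p.head * y.head ^ numBlocks σ 1 *
    ∏ᶠ i : ℕ, ∏ j : Fin (k - 1),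
      x.tail i j ^ kOcc σ (i + 2) (j + 1) (p.tail i j) *
        y.tail i j ^ numBlocksOfType σ (i + 2) (j + 1)

/-- The exponential generating function `G_k^{A,p}(t; x; y)`, as a power series in `t`. -/
noncomputable def kStirlingEGF {R : Type*} [CommRing R] [Algebra ℚ R] (k : ℕ)
    (A : TupleSeq k (Set PermPattern)) (p : TupleSeq k PermPattern) (x y : TupleSeq k R) : R⟦X⟧ :=
  PowerSeries.mk fun n =>
    if n = 0 then 1
    else algebraMap ℚ R (1 / (n.factorial : ℚ)) * ∑ σ ∈ kStirlingAvoiding k n A, kWeight k p x y σ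

/-! ### The generating function for Stirling permutations (no types) -/

/-- `p^{(ℓ)}(σ)`: the number of occurrences of the block pattern `p` at level `ℓ`, where siblings
need not have the same type. -/
noncomputable def levelOcc (σ : List ℕ) (ℓ : ℕ) (p : PermPattern) : ℕ :=
  {b : Fin p.len → ℕ | IsBlockOcc (Sibling σ) σ p b ∧ ∀ a, IsLevel σ ℓ (b a)}.ncard

open Classical in
/-- `𝒬_n(A)`: the Stirling permutations of order `n` that for each level `i ≥ 1` avoid the patterns
of `A_i` at level `i`. Here and below `A_i` is `A (i - 1)`, and similarly for other sequences. -/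
noncomputable def stirlingAvoiding (n : ℕ) (A : ℕ → Set PermPattern) : Finset (List ℕ) :=
  {σ ∈ kStirling 2 n | ∀ i : ℕ, ∀ a ∈ A i, levelOcc σ (i + 1) a = 0}

/-- The exponential generating function `G^{A,p}(t; x; y) = 1 + ∑_{n ≥ 1} (t^n / n!)
∑_{σ ∈ 𝒬_n(A)} ∏_{i ≥ 1} x_i^{p_i^{(i)}(σ)} y_i^{bl^{(i)}(σ)}`, as a power series in `t`. -/
noncomputable def stirlingEGF {R : Type*} [CommRing R] [Algebra ℚ R]
    (A : ℕ → Set PermPattern) (p : ℕ → PermPattern) (x y : ℕ → R) : R⟦X⟧ :=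
  PowerSeries.mk fun n =>
    if n = 0 then 1
    else algebraMap ℚ R (1 / (n.factorial : ℚ)) *
      ∑ σ ∈ stirlingAvoiding n A,
        ∏ᶠ i : ℕ, x i ^ levelOcc σ (i + 1) (p i) * y i ^ numBlocks σ (i + 1)

/-- The formal integral `∫_0^t f(u) du` of a power series. -/
noncomputable def formalIntegral {R : Type*} [CommRing R] [Algebra ℚ R] (f : R⟦X⟧) : R⟦X⟧ :=
  PowerSeries.mk fun n =>
    if n = 0 then 0 else algebraMap ℚ R (1 / (n : ℚ)) * PowerSeries.coeff (n - 1) f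

/-! A `k`-Stirling permutation is a sequence of level 1 blocks `b w_1 b w_2 b ⋯ w_{k-1} b`. Each
letter of `w_s` exceeds `b`, each `w_s` is again a `k`-Stirling word on its own letters, and the
letter sets of all heads and all `w_s` are disjoint. Conversely, any such family
(`IsStirlingForest`) concatenates to a `k`-Stirling word. Existence and uniqueness of this
decomposition are `exists_forest`, `forestWord_mem_words` and `forestWord_inj`; the reason is that
the defining condition is avoidance of 212 as a subword.

The statistics follow the decomposition. Level 1 block patterns depend only on the word of heads
(`kOccOne_eq`). The level 2, type `s` blocks are the level 1 blocks of the words `w_s`, and deeper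
blocks drop one level and keep their type. Occurrences never straddle two of these words, because
their blocks are siblings. Hence the weight factors (`IsForest.avoidingWeight_eq`) into a pattern
weight of the heads, a power of `y_1`, and weights of the `w_s` for the shifted sequences.

The rest is exponential generating function calculus. Weights depend only on the relative order of
letters (`avoidingWeight_map`), so families of structures on disjoint label sets multiply series
(`sum_families`). Since the head of a block is its least letter, removing it amounts to integration
(`sum_blockStructures`). The one factor that does not split over the blocks is the pattern weight of
the heads. All `m!` orderings of a given set of `m` blocks occur and have the same remaining weight,
so summing over them replaces the pattern weight by the coefficient of `F`
(`sum_families_patternWeight`). Summing over `m` gives the composition. For `k = 2` there is only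
one type, so types carry no information. -/

/-! ### Products of exponential generating functions -/

section EGF

variable {R : Type*} [CommRing R]

/-- `n!` times the coefficient of `t ^ n`. -/
noncomputable def egfCoeff (G : R⟦X⟧) (n : ℕ) : R := (n.factorial : R) * PowerSeries.coeff n G

lemma egfCoeff_succ (G : R⟦X⟧) (n : ℕ) :
    egfCoeff G (n + 1) = egfCoeff (PowerSeries.derivative (R := R) G) n := by
  simp only [egfCoeff, PowerSeries.coeff_derivative, Nat.factorial_succ]
  push_cast
  ring

/-- The Leibniz rule is phrased with `Function.update` so that each summand is again a product over
a family, to which an induction hypothesis on families applies. -/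
lemma derivation_prod {A : Type*} [CommRing A] [Algebra R A] (D : Derivation R A A)
    {ι : Type*} [DecidableEq ι] (s : Finset ι) (G : ι → A) :
    D (∏ i ∈ s, G i) = ∑ j ∈ s, ∏ i ∈ s, Function.update G j (D (G j)) i := by
  induction s using Finset.induction_on with
  | empty => simp
  | insert a s ha ih =>
    rw [Finset.prod_insert ha, Derivation.leibniz, ih, Finset.sum_insert ha,
      Finset.prod_insert ha, Function.update_self, smul_eq_mul, smul_eq_mul, Finset.mul_sum,
      add_comm]
    congr 1
    · rw [mul_comm]
      congr 1
      refine Finset.prod_congr rfl fun i hi => ?_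
      rw [Function.update_of_ne]
      rintro rfl
      exact ha hi
    · refine Finset.sum_congr rfl fun j hj => ?_
      rw [Finset.prod_insert ha, Function.update_of_ne]
      rintro rfl
      exact ha hj

/-- Choosing the class `j` of the first element raises the size of that class by one, which is the
same as differentiating the factor `G j`. The sum over `j` is then the Leibniz rule. -/
lemma sum_fin_prod_egfCoeff {ι : Type*} [Fintype ι] [DecidableEq ι] (n : ℕ) (G : ι → R⟦X⟧) :
    ∑ f : Fin n → ι, ∏ i, egfCoeff (G i) (Finset.univ.filter fun a => f a = i).card =
      egfCoeff (∏ i, G i) n := by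
  induction n generalizing G with
  | zero => simp [egfCoeff, map_prod]
  | succ n ih =>
    rw [egfCoeff_succ, derivation_prod, ← (Fin.consEquiv fun _ => ι).sum_comp,
      Fintype.sum_prod_type]
    have : ∀ H : ι → R⟦X⟧, egfCoeff (∑ j, H j) n = ∑ j, egfCoeff (H j) n := fun H => by
      simp [egfCoeff, Finset.mul_sum]
    rw [this]
    refine Finset.sum_congr rfl fun j _ => ?_
    rw [← ih]
    refine Finset.sum_congr rfl fun f _ => Finset.prod_congr rfl fun i _ => ?_
    rw [Fin.card_filter_univ_succ']
    simp only [Fin.consEquiv, Equiv.coe_fn_mk, Fin.cons_zero, Fin.cons_succ]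
    by_cases h : j = i
    · subst h
      simp only [if_true, Function.update_self, ← egfCoeff_succ]
      rw [add_comm]
    · simp [h, Function.update_of_ne (Ne.symm h)]

lemma sum_prod_egfCoeff {ι α : Type*} [Fintype ι] [DecidableEq ι] [Fintype α] [DecidableEq α]
    (G : ι → R⟦X⟧) :
    ∑ f : α → ι, ∏ i, egfCoeff (G i) (Finset.univ.filter fun a => f a = i).card =
      egfCoeff (∏ i, G i) (Fintype.card α) := by
  rw [← sum_fin_prod_egfCoeff]
  refine Fintype.sum_equiv ((Fintype.equivFin α).arrowCongr (Equiv.refl ι)) _ _ fun f => ?_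
  refine Finset.prod_congr rfl fun i _ => ?_
  congr 1
  refine Finset.card_bij (fun a _ => Fintype.equivFin α a) (by simp)
    (by simp) fun b hb => ⟨(Fintype.equivFin α).symm b, by simpa using hb, by simp⟩

end EGF

/-! ### Families of structures whose supports partition a set -/

section Families

variable {ι β : Type*} [DecidableEq ι]

/-- The elements of `S` that `f` sends to `i`. -/
def fiberFinset {S : Finset ℕ} (f : S → ι) (i : ι) : Finset ℕ :=
  (Finset.univ.filter fun a => f a = i).map (Function.Embedding.subtype _)

lemma mem_fiberFinset {S : Finset ℕ} (f : S → ι) (i : ι) (a : ℕ) :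
    a ∈ fiberFinset f i ↔ ∃ h : a ∈ S, f ⟨a, h⟩ = i := by
  simp [fiberFinset]

open Classical in
/-- Families `g` of structures such that `g i` is a structure on a set `T i` (that is, an element
of `C i (T i)`), where the sets `T i` partition `S`. -/
noncomputable def families [Fintype ι] (C : ι → Finset ℕ → Finset β) (S : Finset ℕ) :
    Finset (ι → β) :=
  Finset.univ.biUnion fun f : S → ι => Fintype.piFinset fun i => C i (fiberFinset f i)

variable [Fintype ι] {C : ι → Finset ℕ → Finset β} {supp : β → Finset ℕ}

lemma mem_families (hC : ∀ i T, ∀ b ∈ C i T, supp b = T) {S : Finset ℕ} {g : ι → β} :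
    g ∈ families C S ↔ (∀ i, g i ∈ C i (supp (g i))) ∧
      (∀ i j, i ≠ j → Disjoint (supp (g i)) (supp (g j))) ∧
      ∀ a, a ∈ S ↔ ∃ i, a ∈ supp (g i) := by
  simp only [families, Finset.mem_biUnion, Finset.mem_univ, true_and, Fintype.mem_piFinset]
  constructor
  · rintro ⟨f, hf⟩
    have h : ∀ i, supp (g i) = fiberFinset f i := fun i => hC i _ _ (hf i)
    refine ⟨fun i => by rw [h]; exact hf i, fun i j hij => ?_, fun a => ?_⟩
    · rw [Finset.disjoint_left]
      intro a
      simp only [h, mem_fiberFinset]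
      rintro ⟨h1, rfl⟩ ⟨_, h2⟩
      exact hij h2
    · simp only [h, mem_fiberFinset]
      exact ⟨fun ha => ⟨_, ha, rfl⟩, fun ⟨_, ha, _⟩ => ha⟩
  · rintro ⟨h1, h2, h3⟩
    choose f hf using fun a : S => (h3 a).1 a.2
    refine ⟨f, fun i => ?_⟩
    convert h1 i
    ext a
    rw [mem_fiberFinset]
    constructor
    · rintro ⟨ha, rfl⟩
      exact hf ⟨a, ha⟩
    · intro ha
      have haS := (h3 a).2 ⟨i, ha⟩
      refine ⟨haS, ?_⟩
      by_contra hne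
      exact Finset.disjoint_left.1 (h2 _ _ hne) (hf ⟨a, haS⟩) ha

/-- The supports of a family determine the map `f` that distributes the labels, so the union over
`f` is disjoint. For fixed `f` the sum of products is a product of sums, each depending only on the
size of a fibre. -/
lemma sum_families {R : Type*} [CommRing R] (hC : ∀ i T, ∀ b ∈ C i T, supp b = T)
    (v : ι → β → R) (G : ι → R⟦X⟧)
    (hG : ∀ i T, ∑ b ∈ C i T, v i b = egfCoeff (G i) T.card) (S : Finset ℕ) :
    ∑ g ∈ families C S, ∏ i, v i (g i) = egfCoeff (∏ i, G i) S.card := by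
  classical
  have hdisj : Set.PairwiseDisjoint (↑(Finset.univ : Finset (S → ι)) : Set (S → ι))
      (fun f => Fintype.piFinset fun i => C i (fiberFinset f i)) := by
    intro f _ f' _ hne
    rw [Function.onFun, Finset.disjoint_left]
    intro g hg hg'
    apply hne
    simp only [Fintype.mem_piFinset] at hg hg'
    funext a
    have h1 : (a : ℕ) ∈ fiberFinset f (f a) := (mem_fiberFinset f _ _).2 ⟨a.2, rfl⟩
    rw [← hC _ _ _ (hg (f a)), hC _ _ _ (hg' (f a)), mem_fiberFinset] at h1
    exact h1.2.symm
  rw [families, Finset.sum_biUnion hdisj, ← Fintype.card_coe S, ← sum_prod_egfCoeff]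
  refine Finset.sum_congr rfl fun f _ => ?_
  rw [← Finset.prod_univ_sum]
  refine Finset.prod_congr rfl fun i _ => ?_
  rw [hG, fiberFinset, Finset.card_map]

end Families

/-! ### Symmetrization of pattern statistics -/

open Classical in
/-- The contribution of a word `b` to `F^{A,p}(t,z)`. -/
noncomputable def patternWeight {R : Type*} [CommRing R] (A : Set PermPattern) (p : PermPattern)
    (z : R) {m : ℕ} (b : Fin m → ℕ) : R :=
  if ∀ a ∈ A, {i : Fin a.len → Fin m | a.IsOcc b i}.ncard = 0
  then z ^ {i : Fin p.len → Fin m | p.IsOcc b i}.ncard else 0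

lemma PermPattern.isOcc_congr (p : PermPattern) {m : ℕ} {b c : Fin m → ℕ}
    (h : ∀ i j, b i < b j ↔ c i < c j) (i : Fin p.len → Fin m) : p.IsOcc b i ↔ p.IsOcc c i := by
  simp only [PermPattern.IsOcc, PermPattern.OrderIso, h]

section

variable {R : Type*} [CommRing R] {A : Set PermPattern} {p : PermPattern} {z : R}

lemma patternWeight_congr {m : ℕ} {b c : Fin m → ℕ} (h : ∀ i j, b i < b j ↔ c i < c j) :
    patternWeight A p z b = patternWeight A p z c := by
  have h' : ∀ q : PermPattern, {i : Fin q.len → Fin m | q.IsOcc b i} = {i | q.IsOcc c i} :=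
    fun q => Set.ext (q.isOcc_congr h)
  unfold patternWeight
  classical
  apply if_congr
  · simp_rw [h']
  · rw [h']
  · rfl

lemma sum_patternWeight_perm (m : ℕ) :
    ∑ π : Equiv.Perm (Fin m), patternWeight A p z (fun i => (π i : ℕ)) =
      ∑ π ∈ avoidingPerms A m, z ^ p.occ π := by
  unfold avoidingPerms
  rw [Finset.sum_filter]
  rfl

/-- The arrangements of `m` distinct numbers are, up to order isomorphism, the permutations of
length `m`; translating by the sorting permutation of `b` matches the two sums. -/
lemma sum_patternWeight_comp {m : ℕ} {b : Fin m → ℕ} (hb : Function.Injective b) :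
    ∑ ρ : Equiv.Perm (Fin m), patternWeight A p z (b ∘ ρ) =
      ∑ π ∈ avoidingPerms A m, z ^ p.occ π := by
  rw [← sum_patternWeight_perm]
  have hs : StrictMono (b ∘ Tuple.sort b) :=
    (Tuple.monotone_sort b).strictMono_of_injective (hb.comp (Tuple.sort b).injective)
  refine Fintype.sum_equiv (Equiv.mulLeft (Tuple.sort b)⁻¹) _ _ fun ρ => ?_
  refine patternWeight_congr fun i j => ?_
  simp only [Function.comp_apply, Equiv.coe_mulLeft, Equiv.Perm.coe_mul, Fin.val_fin_lt]
  rw [← hs.lt_iff_lt]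
  simp [Function.comp_apply]

end

/-! ### Coefficients of a composite power series -/

lemma coeff_pow_eq_zero {R : Type*} [CommRing R] {f : R⟦X⟧} (hf : PowerSeries.constantCoeff f = 0)
    {n m : ℕ} (h : n < m) : PowerSeries.coeff n (f ^ m) = 0 := by
  obtain ⟨g, rfl⟩ := PowerSeries.X_dvd_iff.2 hf
  rw [mul_pow, PowerSeries.coeff_X_pow_mul', if_neg (by omega)]

lemma coeff_subst_eq_sum {R : Type*} [CommRing R] {f a : R⟦X⟧}
    (ha : PowerSeries.constantCoeff a = 0) {n N : ℕ} (hN : n < N) :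
    PowerSeries.coeff n (f.subst a) =
      ∑ m ∈ Finset.range N, PowerSeries.coeff m f * PowerSeries.coeff n (a ^ m) := by
  rw [PowerSeries.coeff_subst' (PowerSeries.HasSubst.of_constantCoeff_zero' ha)]
  simp only [smul_eq_mul]
  refine finsum_eq_sum_of_support_subset _ fun m hm => ?_
  simp only [Finset.coe_range, Set.mem_Iio]
  by_contra hlt
  exact hm (by simp [coeff_pow_eq_zero ha (show n < m by omega)])

/-! ### Words avoiding 212 -/

/-- No letter `x` between two occurrences of a letter `i` is smaller than `i`. -/
def Avoids212 (σ : List ℕ) : Prop := ∀ i x, [i, x, i].Sublist σ → i ≤ x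

lemma triple_sublist_iff {σ : List ℕ} {i x y : ℕ} :
    [i, x, y].Sublist σ ↔ ∃ a b c : Fin σ.length, a < b ∧ b < c ∧
      σ[a] = i ∧ σ[b] = x ∧ σ[c] = y := by
  rw [List.sublist_iff_exists_fin_orderEmbedding_get_eq]
  constructor
  · rintro ⟨f, hf⟩
    refine ⟨f ⟨0, by simp⟩, f ⟨1, by simp⟩, f ⟨2, by simp⟩, f.strictMono (by simp),
      f.strictMono (by simp), ?_, ?_, ?_⟩
    · simpa using (hf ⟨0, by simp⟩).symm
    · simpa using (hf ⟨1, by simp⟩).symm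
    · simpa using (hf ⟨2, by simp⟩).symm
  · rintro ⟨a, b, c, hab, hbc, rfl, rfl, rfl⟩
    refine ⟨OrderEmbedding.ofStrictMono ![a, b, c] ?_, ?_⟩
    · refine Fin.strictMono_iff_lt_succ.2 fun i => ?_
      fin_cases i
      · exact hab
      · exact hbc
    · intro ix
      fin_cases ix <;> simp

/-- The subword form does not refer to consecutive occurrences, so it passes to sublists and suits
concatenations. Its weak inequality costs nothing, since a letter strictly between consecutive
occurrences of `i` differs from `i`. -/
lemma isStirlingWord_iff {σ : List ℕ} : IsStirlingWord σ ↔ Avoids212 σ := by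
  constructor
  · intro h i x hs
    obtain ⟨a, b, c, hab, hbc, ha, hb, hc⟩ := triple_sublist_iff.1 hs
    by_contra hlt
    have hne : σ[b] ≠ i := by omega
    -- The last occurrence of `i` to the left of `b` and the first one to its right are consecutive
    -- occurrences of `i`.
    let P := Finset.univ.filter fun j : Fin σ.length => j < b ∧ σ[j] = i
    let Q := Finset.univ.filter fun j : Fin σ.length => b < j ∧ σ[j] = i
    have hP : P.Nonempty := ⟨a, by simp [P, hab]; exact ha⟩
    have hQ : Q.Nonempty := ⟨c, by simp [Q, hbc]; exact hc⟩
    have hPm := P.max'_mem hP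
    have hQm := Q.min'_mem hQ
    set a' := P.max' hP with ha'
    set c' := Q.min' hQ with hc'
    simp only [P, Q, Finset.mem_filter, Finset.mem_univ, true_and] at hPm hQm
    have := h a' c' (hPm.1.trans hQm.1) (hPm.2.trans hQm.2.symm) (fun d hd1 hd2 hd => ?_) b
      hPm.1 hQm.1
    · rw [hPm.2, hb] at this
      omega
    · rw [hPm.2] at hd
      rcases lt_trichotomy d b with hdb | hdb | hdb
      · have : d ≤ a' := P.le_max' d (Finset.mem_filter.2 ⟨Finset.mem_univ _, hdb, hd⟩)
        exact absurd hd1 (not_lt.2 this)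
      · subst hdb
        exact hne hd
      · have : c' ≤ d := Q.min'_le d (Finset.mem_filter.2 ⟨Finset.mem_univ _, hdb, hd⟩)
        exact absurd hd2 (not_lt.2 this)
  · intro h a c hac hσ hb b hab hbc
    refine lt_of_le_of_ne (h _ _ (triple_sublist_iff.2 ⟨a, b, c, hab, hbc, rfl, rfl, hσ.symm⟩)) ?_
    exact (hb b hab hbc).symm

lemma Avoids212.sublist {σ τ : List ℕ} (h : Avoids212 σ) (hs : τ.Sublist σ) : Avoids212 τ :=
  fun i x hx => h i x (hx.trans hs)

/-- A subword beginning and ending with `x` lies in every segment that contains all the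
occurrences of `x`. -/
lemma triple_sublist_of_append {u w v : List ℕ} {x y : ℕ} (hu : x ∉ u) (hv : x ∉ v)
    (h : [x, y, x].Sublist (u ++ w ++ v)) : [x, y, x].Sublist w := by
  rw [List.sublist_append_iff] at h
  obtain ⟨l₁, l₂, hl, h1, h2⟩ := h
  have hl2 : l₂ = [] := by
    rcases List.eq_nil_or_concat l₂ with h | ⟨l, z, rfl⟩
    · exact h
    · rw [List.concat_eq_append, ← List.append_assoc] at hl
      have : z = x := by
        have := congrArg List.getLast? hl
        simpa using this.symm
      subst this
      exact absurd (h2.subset (by simp)) hv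
  subst hl2
  rw [List.append_nil] at hl
  subst hl
  rw [List.sublist_append_iff] at h1
  obtain ⟨l₁, l₂, hl, h1, h2⟩ := h1
  cases l₁ with
  | nil =>
    rw [List.nil_append] at hl
    rw [hl]
    exact h2
  | cons z l =>
    obtain ⟨rfl, -⟩ := List.cons_eq_cons.1 hl
    exact absurd (h1.subset (by simp)) hu

open Classical in
/-- The words that contain every letter of `S` exactly `k` times, no other letters, and
avoid 212. -/
noncomputable def words (k : ℕ) (S : Finset ℕ) : Finset (List ℕ) :=
  {σ ∈ (S.toList.flatMap (List.replicate k)).permutations.toFinset | Avoids212 σ}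

lemma count_flatMap_replicate (k a : ℕ) {l : List ℕ} (hl : l.Nodup) :
    (l.flatMap (List.replicate k)).count a = if a ∈ l then k else 0 := by
  induction l with
  | nil => simp
  | cons b l ih =>
    rw [List.nodup_cons] at hl
    rw [List.flatMap_cons, List.count_append, ih hl.2, List.count_replicate]
    by_cases hab : b = a
    · subst hab
      simp [hl.1]
    · simp [hab, Ne.symm hab]

lemma mem_words {k : ℕ} {S : Finset ℕ} {σ : List ℕ} :
    σ ∈ words k S ↔ (∀ a, σ.count a = if a ∈ S then k else 0) ∧ Avoids212 σ := by
  simp [words, List.perm_iff_count, count_flatMap_replicate _ _ S.nodup_toList]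

lemma kStirling_eq_words (k n : ℕ) : kStirling k n = words k (Finset.Icc 1 n) := by
  ext σ
  have h : sortedWord k n = ((List.range n).map (· + 1)).flatMap (List.replicate k) := by
    rw [sortedWord, List.flatMap_map]
  have hn : ((List.range n).map (· + 1)).Nodup :=
    List.nodup_range.map (add_left_injective 1)
  simp only [kStirling, Finset.mem_filter, List.mem_toFinset, List.mem_permutations,
    List.perm_iff_count, mem_words, isStirlingWord_iff, h, count_flatMap_replicate _ _ hn]
  refine and_congr_left fun _ => forall_congr' fun a => ?_
  have : a ∈ (List.range n).map (· + 1) ↔ a ∈ Finset.Icc 1 n := by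
    simp only [List.mem_map, List.mem_range, Finset.mem_Icc]
    constructor
    · rintro ⟨b, hb, rfl⟩
      omega
    · intro hab
      exact ⟨a - 1, by omega, by omega⟩
  simp only [this]

/-- For `k = 0` the empty word would be the only word on every `S`, and the letter set could not be
recovered. -/
lemma toFinset_of_mem_words {k : ℕ} (hk : 1 ≤ k) {S : Finset ℕ} {σ : List ℕ}
    (h : σ ∈ words k S) : σ.toFinset = S := by
  ext a
  rw [List.mem_toFinset, ← List.count_pos_iff, (mem_words.1 h).1 a]
  split_ifs with ha
  · simp [ha]; omega
  · simp [ha]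

lemma mem_words_toFinset {k : ℕ} {σ : List ℕ} :
    σ ∈ words k σ.toFinset ↔ (∀ a ∈ σ, σ.count a = k) ∧ Avoids212 σ := by
  rw [mem_words]
  refine and_congr_left fun _ => forall_congr' fun a => ?_
  by_cases ha : a ∈ σ <;> simp [ha, List.count_eq_zero_of_not_mem]

/-! ### Concatenations -/

/-- The concatenation of the words `τ 0, …, τ (m - 1)`. -/
def concatFn {m : ℕ} (τ : Fin m → List ℕ) : List ℕ := (List.ofFn τ).flatten

lemma concatFn_zero (τ : Fin 0 → List ℕ) : concatFn τ = [] := by simp [concatFn]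

lemma concatFn_succ {m : ℕ} (τ : Fin (m + 1) → List ℕ) :
    concatFn τ = τ 0 ++ concatFn fun i => τ i.succ := by simp [concatFn, List.ofFn_succ]

lemma mem_concatFn {m : ℕ} {τ : Fin m → List ℕ} {a : ℕ} : a ∈ concatFn τ ↔ ∃ i, a ∈ τ i := by
  simp [concatFn, List.mem_flatten, List.mem_ofFn]

lemma count_concatFn {m : ℕ} (τ : Fin m → List ℕ) (a : ℕ) :
    (concatFn τ).count a = ∑ i, (τ i).count a := by
  induction m with
  | zero => simp [concatFn_zero]
  | succ m ih => rw [concatFn_succ, List.count_append, ih, Fin.sum_univ_succ]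

lemma concatFn_map {m : ℕ} (τ : Fin m → List ℕ) (φ : ℕ → ℕ) :
    (concatFn τ).map φ = concatFn fun i => (τ i).map φ := by
  induction m with
  | zero => simp [concatFn_zero]
  | succ m ih => rw [concatFn_succ, List.map_append, ih, concatFn_succ]

/-- The concatenation of the first `n` of the words `τ`. -/
def prefixFn {m : ℕ} (τ : Fin m → List ℕ) (n : ℕ) : List ℕ := ((List.ofFn τ).take n).flatten

/-- The concatenation of all but the first `n` of the words `τ`. -/
def suffixFn {m : ℕ} (τ : Fin m → List ℕ) (n : ℕ) : List ℕ := ((List.ofFn τ).drop n).flatten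

lemma prefixFn_zero {m : ℕ} (τ : Fin m → List ℕ) : prefixFn τ 0 = [] := by simp [prefixFn]

lemma prefixFn_succ {m : ℕ} (τ : Fin m → List ℕ) (i : Fin m) :
    prefixFn τ (i + 1) = prefixFn τ i ++ τ i := by
  simp [prefixFn, List.take_add_one, List.flatten_append]

lemma concatFn_eq {m : ℕ} (τ : Fin m → List ℕ) (i : Fin m) :
    concatFn τ = prefixFn τ i ++ τ i ++ suffixFn τ (i + 1) := by
  rw [← prefixFn_succ, prefixFn, suffixFn, ← List.flatten_append, List.take_append_drop, concatFn]

lemma mem_prefixFn {m : ℕ} {τ : Fin m → List ℕ} {n a : ℕ} :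
    a ∈ prefixFn τ n ↔ ∃ j : Fin m, (j : ℕ) < n ∧ a ∈ τ j := by
  simp only [prefixFn, List.mem_flatten, List.mem_take_iff_getElem, List.getElem_ofFn]
  constructor
  · rintro ⟨l, ⟨i, hi, rfl⟩, ha⟩
    simp only [List.length_ofFn, lt_min_iff] at hi
    exact ⟨⟨i, hi.2⟩, hi.1, ha⟩
  · rintro ⟨j, hj, ha⟩
    exact ⟨_, ⟨j, by simp [hj], rfl⟩, ha⟩

lemma mem_suffixFn {m : ℕ} {τ : Fin m → List ℕ} {n a : ℕ} :
    a ∈ suffixFn τ n ↔ ∃ j : Fin m, n ≤ (j : ℕ) ∧ a ∈ τ j := by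
  simp only [suffixFn, List.mem_flatten, List.mem_drop_iff_getElem, List.getElem_ofFn]
  constructor
  · rintro ⟨l, ⟨i, hi, rfl⟩, ha⟩
    simp only [List.length_ofFn] at hi
    exact ⟨⟨_, by omega⟩, by simp, ha⟩
  · rintro ⟨j, hj, ha⟩
    refine ⟨_, ⟨j - n, by simp; omega, rfl⟩, ?_⟩
    convert ha using 2
    exact Fin.ext (by simp only []; omega)

/-! ### Forests -/

/-- The word `b w_1 b w_2 b ⋯ b w_r b`. -/
def blockWord {r : ℕ} (b : ℕ) (w : Fin r → List ℕ) : List ℕ := b :: concatFn fun s => w s ++ [b]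

/-- The concatenation of the words `blockWord b w` for the pairs `(b, w)` of the family `g`. -/
def forestWord {m r : ℕ} (g : Fin m → ℕ × (Fin r → List ℕ)) : List ℕ :=
  concatFn fun i => blockWord (g i).1 (g i).2

/-- The letters of all the words in `g` are different, except that letters may repeat within
one of the words `(g i).2 s`. -/
structure IsForest {m r : ℕ} (g : Fin m → ℕ × (Fin r → List ℕ)) : Prop where
  head_inj : ∀ i j, (g i).1 = (g j).1 → i = j
  head_notMem : ∀ i j s, (g i).1 ∉ (g j).2 s
  disj : ∀ a i s j t, a ∈ (g i).2 s → a ∈ (g j).2 t → i = j ∧ s = t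

/-- `g` is the decomposition of a `(r + 1)`-Stirling permutation into its level 1 blocks. -/
structure IsStirlingForest {m r : ℕ} (g : Fin m → ℕ × (Fin r → List ℕ)) : Prop
    extends IsForest g where
  head_lt : ∀ i s, ∀ a ∈ (g i).2 s, (g i).1 < a
  mem_words : ∀ i s, (g i).2 s ∈ words (r + 1) ((g i).2 s).toFinset

lemma mem_blockWord {r : ℕ} {b : ℕ} {w : Fin r → List ℕ} {a : ℕ} :
    a ∈ blockWord b w ↔ a = b ∨ ∃ s, a ∈ w s := by
  simp only [blockWord, List.mem_cons, mem_concatFn, List.mem_append, List.not_mem_nil, or_false]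
  constructor
  · rintro (h | ⟨s, h | h⟩)
    · exact .inl h
    · exact .inr ⟨s, h⟩
    · exact .inl h
  · rintro (h | ⟨s, h⟩)
    · exact .inl h
    · exact .inr ⟨s, .inl h⟩

lemma mem_forestWord {m r : ℕ} {g : Fin m → ℕ × (Fin r → List ℕ)} {a : ℕ} :
    a ∈ forestWord g ↔ ∃ i, a = (g i).1 ∨ ∃ s, a ∈ (g i).2 s := by
  simp only [forestWord, mem_concatFn, mem_blockWord]

lemma forestWord_succ {m r : ℕ} (g : Fin (m + 1) → ℕ × (Fin r → List ℕ)) :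
    forestWord g = blockWord (g 0).1 (g 0).2 ++ forestWord fun i => g i.succ := by
  rw [forestWord, concatFn_succ, forestWord]

lemma forestWord_map {m r : ℕ} (g : Fin m → ℕ × (Fin r → List ℕ)) (φ : ℕ → ℕ) :
    (forestWord g).map φ = forestWord fun i => (φ (g i).1, fun s => ((g i).2 s).map φ) := by
  simp [forestWord, concatFn_map, blockWord]

lemma blockWord_eq {r : ℕ} (b : ℕ) (w : Fin r → List ℕ) (s : Fin r) :
    blockWord b w = (b :: prefixFn (fun s => w s ++ [b]) s) ++ w s ++
      (b :: suffixFn (fun s => w s ++ [b]) (s + 1)) := by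
  rw [blockWord, concatFn_eq _ s]
  simp

lemma count_blockWord_self {r : ℕ} {b : ℕ} {w : Fin r → List ℕ} (h : ∀ s, b ∉ w s) :
    (blockWord b w).count b = r + 1 := by
  simp [blockWord, count_concatFn, List.count_eq_zero_of_not_mem (h _)]

lemma count_blockWord_of_ne {r : ℕ} {a b : ℕ} {w : Fin r → List ℕ} (h : a ≠ b) :
    (blockWord b w).count a = ∑ s, (w s).count a := by
  simp [blockWord, count_concatFn, Ne.symm h]

lemma append_cons_inj_of_notMem_left {α : Type*} {b : α} {x y u v : List α} (hx : b ∉ x)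
    (hy : b ∉ y) (h : x ++ b :: u = y ++ b :: v) : x = y ∧ u = v := by
  induction x generalizing y with
  | nil =>
    cases y with
    | nil => simpa using h
    | cons c y =>
      simp only [List.nil_append, List.cons_append, List.cons.injEq] at h
      simp [h.1] at hy
  | cons d x ih =>
    cases y with
    | nil =>
      simp only [List.nil_append, List.cons_append, List.cons.injEq] at h
      simp [h.1] at hx
    | cons c y =>
      simp only [List.cons_append, List.cons.injEq, List.mem_cons, not_or] at h hx hy
      obtain ⟨rfl, rfl⟩ := ih hx.2 hy.2 h.2
      simp [h.1]

/-- The letter `b` acts as a delimiter, so the first `r` of its occurrences determine where to cut.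
-/
lemma concatFn_append_inj {b r : ℕ} {w w' : Fin r → List ℕ} {u u' : List ℕ} (hw : ∀ s, b ∉ w s)
    (hw' : ∀ s, b ∉ w' s)
    (h : concatFn (fun s => w s ++ [b]) ++ u = concatFn (fun s => w' s ++ [b]) ++ u') :
    w = w' ∧ u = u' := by
  induction r with
  | zero => exact ⟨Subsingleton.elim _ _, by simpa [concatFn_zero] using h⟩
  | succ r ih =>
    simp only [concatFn_succ, List.append_assoc, List.singleton_append] at h
    obtain ⟨h0, h⟩ := append_cons_inj_of_notMem_left (hw 0) (hw' 0) h
    obtain ⟨hs, hu⟩ := ih (fun s => hw s.succ) (fun s => hw' s.succ) h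
    refine ⟨funext fun s => ?_, hu⟩
    refine Fin.cases h0 (fun s => ?_) s
    exact congrFun hs s

lemma IsForest.tail {m r : ℕ} {g : Fin (m + 1) → ℕ × (Fin r → List ℕ)} (hg : IsForest g) :
    IsForest fun i => g i.succ where
  head_inj i j h := Fin.succ_injective _ (hg.head_inj _ _ h)
  head_notMem i j s := hg.head_notMem _ _ _
  disj a i s j t h h' := by simpa using hg.disj a _ s _ t h h'

/-- The first letter is the first head, and its occurrences delimit the words of the first block;
the remaining blocks follow by induction. Comparing lists avoids a dependent equality, as `m = m'`
is part of the conclusion. -/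
lemma forestWord_inj {m m' r : ℕ} {g : Fin m → ℕ × (Fin r → List ℕ)}
    {g' : Fin m' → ℕ × (Fin r → List ℕ)} (hg : IsForest g) (hg' : IsForest g')
    (h : forestWord g = forestWord g') : List.ofFn g = List.ofFn g' := by
  induction m generalizing m' with
  | zero =>
    cases m' with
    | zero => simp
    | succ m' => rw [forestWord_succ] at h; simp [blockWord, forestWord, concatFn_zero] at h
  | succ m ih =>
    cases m' with
    | zero => rw [forestWord_succ] at h; simp [blockWord, forestWord, concatFn_zero] at h
    | succ m' =>
      rw [forestWord_succ, forestWord_succ, blockWord, blockWord, List.cons_append,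
        List.cons_append, List.cons_eq_cons] at h
      obtain ⟨h0, h⟩ := h
      rw [← h0] at h
      obtain ⟨hw, h⟩ := concatFn_append_inj (fun s => hg.head_notMem 0 0 s)
        (fun s => by rw [h0]; exact hg'.head_notMem 0 0 s) h
      rw [List.ofFn_succ, List.ofFn_succ, ih hg.tail hg'.tail h, Prod.ext h0 hw]

/-- All occurrences of `x` lie in one block, hence so does a subword `x y x`. If `x` is the head it
is the least letter of the block; otherwise the subword lies inside a single `(g i).2 s`, which
avoids 212. -/
lemma forestWord_avoids {m r : ℕ} {g : Fin m → ℕ × (Fin r → List ℕ)} (hg : IsStirlingForest g) :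
    Avoids212 (forestWord g) := by
  have hdisj : ∀ x i j, x ∈ blockWord (g i).1 (g i).2 → x ∈ blockWord (g j).1 (g j).2 → i = j := by
    intro x i j hi hj
    rw [mem_blockWord] at hi hj
    rcases hi with rfl | ⟨s, hs⟩ <;> rcases hj with hj | ⟨t, ht⟩
    · exact hg.head_inj _ _ hj
    · exact absurd ht (hg.head_notMem _ _ _)
    · exact absurd (hj ▸ hs) (hg.head_notMem _ _ _)
    · exact (hg.disj _ _ _ _ _ hs ht).1
  intro x y hxy
  obtain ⟨i, hi⟩ := mem_concatFn.1 (hxy.subset (List.mem_cons_self (a := x)))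
  rw [forestWord, concatFn_eq _ i] at hxy
  have h1 := triple_sublist_of_append (fun h => ?_) (fun h => ?_) hxy
  rotate_left
  · obtain ⟨j, hj, hxj⟩ := mem_prefixFn.1 h
    obtain rfl := hdisj _ _ _ hi hxj
    exact lt_irrefl _ hj
  · obtain ⟨j, hj, hxj⟩ := mem_suffixFn.1 h
    obtain rfl := hdisj _ _ _ hi hxj
    omega
  rcases mem_blockWord.1 hi with rfl | ⟨s, hs⟩
  · rcases mem_blockWord.1 (h1.subset (show y ∈ _ by simp)) with rfl | ⟨s, hs⟩
    · exact le_rfl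
    · exact (hg.head_lt _ _ _ hs).le
  · have hne : x ≠ (g i).1 := fun h => hg.head_notMem i i s (h ▸ hs)
    rw [blockWord_eq _ _ s] at h1
    refine (mem_words_toFinset.1 (hg.mem_words i s)).2 x y
      (triple_sublist_of_append (fun h => ?_) (fun h => ?_) h1)
    · simp only [List.mem_cons, mem_prefixFn, List.mem_append, List.not_mem_nil, or_false] at h
      rcases h with h | ⟨t, ht, h | h⟩
      · exact hne h
      · have := (hg.disj _ _ _ _ _ hs h).2
        subst this
        exact lt_irrefl _ ht
      · exact hne h
    · simp only [List.mem_cons, mem_suffixFn, List.mem_append, List.not_mem_nil,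
        or_false] at h
      rcases h with h | ⟨t, ht, h | h⟩
      · exact hne h
      · have := (hg.disj _ _ _ _ _ hs h).2
        subst this
        omega
      · exact hne h

lemma forestWord_mem_words {m r : ℕ} {g : Fin m → ℕ × (Fin r → List ℕ)}
    (hg : IsStirlingForest g) : forestWord g ∈ words (r + 1) (forestWord g).toFinset := by
  refine mem_words_toFinset.2 ⟨fun a ha => ?_, forestWord_avoids hg⟩
  obtain ⟨i, ha⟩ := mem_forestWord.1 ha
  rw [forestWord, count_concatFn, Finset.sum_eq_single i]
  · rcases ha with rfl | ⟨s, hs⟩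
    · exact count_blockWord_self fun s => hg.head_notMem _ _ _
    · have hne : a ≠ (g i).1 := fun h => hg.head_notMem i i s (h ▸ hs)
      rw [count_blockWord_of_ne hne, Finset.sum_eq_single s]
      · exact (mem_words_toFinset.1 (hg.mem_words i s)).1 a hs
      · intro t _ hts
        exact List.count_eq_zero_of_not_mem fun h => hts (hg.disj _ _ _ _ _ h hs).2
      · simp
  · intro j _ hji
    refine List.count_eq_zero_of_not_mem fun h => hji ?_
    rcases ha with rfl | ⟨s, hs⟩ <;> rcases mem_blockWord.1 h with h | ⟨t, h⟩
    · exact (hg.head_inj _ _ h).symm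
    · exact absurd h (hg.head_notMem _ _ _)
    · exact absurd (h ▸ hs) (hg.head_notMem _ _ _)
    · exact (hg.disj _ _ _ _ _ h hs).1
  · simp

lemma exists_eq_concatFn_append (b : ℕ) (j : ℕ) (l : List ℕ) (h : l.count b = j) :
    ∃ (w : Fin j → List ℕ) (u : List ℕ), (∀ s, b ∉ w s) ∧ b ∉ u ∧
      l = concatFn (fun s => w s ++ [b]) ++ u := by
  induction j generalizing l with
  | zero => exact ⟨Fin.elim0, l, fun s => s.elim0, List.count_eq_zero.1 h, by simp [concatFn_zero]⟩
  | succ j ih =>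
    have hb : b ∈ l := List.count_pos_iff.1 (by omega)
    obtain ⟨x, y, rfl, hx⟩ := List.eq_append_cons_of_mem hb
    rw [List.count_append, List.count_cons_self, List.count_eq_zero_of_not_mem hx] at h
    obtain ⟨w, u, hw, hu, rfl⟩ := ih y (by omega)
    refine ⟨Fin.cons x w, u, Fin.cases (by simpa using hx) (by simpa using hw), hu, ?_⟩
    simp [concatFn_succ]

/-- Cutting at the `r + 1` occurrences of the first letter splits off the first block. Avoidance of
212 yields all the order and disjointness conditions, and the remainder `u` is shorter. -/
lemma exists_forest {r : ℕ} (σ : List ℕ) (h : σ ∈ words (r + 1) σ.toFinset) :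
    ∃ (m : ℕ) (g : Fin m → ℕ × (Fin r → List ℕ)), IsStirlingForest g ∧ forestWord g = σ := by
  induction hn : σ.length using Nat.strong_induction_on generalizing σ with
  | _ n ih =>
  obtain ⟨hc, hav⟩ := mem_words_toFinset.1 h
  cases σ with
  | nil =>
    exact ⟨0, Fin.elim0, ⟨⟨fun i => i.elim0, fun i => i.elim0, fun _ i => i.elim0⟩,
      fun i => i.elim0, fun i => i.elim0⟩, by simp [forestWord, concatFn_zero]⟩
  | cons b l =>
    have hb := hc b (by simp)
    rw [List.count_cons_self, Nat.add_right_cancel_iff] at hb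
    obtain ⟨w, u, hw, hu, rfl⟩ := exists_eq_concatFn_append b r l hb
    have hword : b :: (concatFn (fun s => w s ++ [b]) ++ u) = blockWord b w ++ u := rfl
    rw [hword] at hc hav hn h
    -- `a` stands between two occurrences of `b`, so 212-avoidance gives `b ≤ a`.
    have hlt : ∀ s, ∀ a ∈ w s, b < a := by
      intro s a ha
      have hab : a ≠ b := fun h => hw s (h ▸ ha)
      have h1 : [a, b].Sublist (w s ++ [b]) :=
        (List.singleton_sublist.2 ha).append (List.Sublist.refl [b])
      refine lt_of_le_of_ne (hav b a ?_) hab.symm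
      refine List.Sublist.trans ?_ (List.sublist_append_left _ _)
      refine List.Sublist.cons_cons _ ?_
      rw [concatFn_eq _ s]
      exact h1.trans ((List.sublist_append_right _ _).trans (List.sublist_append_left _ _))
    -- A second `a` beyond `w s` would enclose the smaller letter `b` that closes `w s`, giving the
    -- forbidden subword `a b a`. The same argument separates different words `w s` and `w t` below.
    have hwu : ∀ s, ∀ a ∈ w s, a ∉ u := by
      intro s a ha hau
      refine absurd (hav a b ?_) (not_le.2 (hlt s a ha))
      have h1 : [a, b].Sublist (blockWord b w) := by
        refine List.Sublist.cons _ ?_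
        rw [concatFn_eq _ s]
        refine List.Sublist.trans ?_ ((List.sublist_append_right _ _).trans
          (List.sublist_append_left _ _))
        exact (List.singleton_sublist.2 ha).append (List.Sublist.refl [b])
      exact h1.append (List.singleton_sublist.2 hau)
    have hww : ∀ s t, s < t → ∀ a ∈ w s, a ∉ w t := by
      intro s t hst a ha hat
      refine absurd (hav a b ?_) (not_le.2 (hlt s a ha))
      refine List.Sublist.trans ?_ (List.sublist_append_left _ _)
      refine List.Sublist.cons _ ?_
      rw [concatFn_eq _ s, List.append_assoc]
      refine List.Sublist.trans ?_ (List.sublist_append_right _ _)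
      refine List.Sublist.append (l₁ := [a, b]) ?_ ?_
      · exact (List.singleton_sublist.2 ha).append (List.Sublist.refl [b])
      · exact List.singleton_sublist.2 (mem_suffixFn.2 ⟨t, hst, by simp [hat]⟩)
    have hww' : ∀ a s t, a ∈ w s → a ∈ w t → s = t := by
      intro a s t hs ht
      rcases lt_trichotomy s t with h | h | h
      · exact absurd ht (hww s t h a hs)
      · exact h
      · exact absurd hs (hww t s h a ht)
    have hcu : ∀ a ∈ u, (blockWord b w).count a = 0 := by
      intro a ha
      refine List.count_eq_zero_of_not_mem fun h => ?_
      rcases mem_blockWord.1 h with rfl | ⟨s, hs⟩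
      · exact hu ha
      · exact hwu s a hs ha
    obtain ⟨m, g, hg, rfl⟩ := ih u.length (by rw [← hn]; simp [blockWord]) u
      (mem_words_toFinset.2 ⟨fun a ha => by
        have := hc a (by simp [ha])
        rwa [List.count_append, hcu a ha, zero_add] at this,
        hav.sublist (List.sublist_append_right _ _)⟩) rfl
    refine ⟨m + 1, Fin.cons (b, w) g, ⟨⟨?_, ?_, ?_⟩, ?_, ?_⟩, ?_⟩
    · intro i j
      refine Fin.cases ?_ (fun i => ?_) i <;> refine Fin.cases ?_ (fun j => ?_) j
      · simp
      · simp only [Fin.cons_zero, Fin.cons_succ]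
        intro h
        exact absurd (mem_forestWord.2 ⟨j, .inl h⟩) hu
      · simp only [Fin.cons_zero, Fin.cons_succ]
        intro h
        exact absurd (mem_forestWord.2 ⟨i, .inl h.symm⟩) hu
      · simp only [Fin.cons_succ]
        intro h
        rw [hg.head_inj _ _ h]
    · intro i j s
      refine Fin.cases ?_ (fun i => ?_) i <;> refine Fin.cases ?_ (fun j => ?_) j
      · exact hw s
      · simp only [Fin.cons_zero, Fin.cons_succ]
        exact fun h => hu (mem_forestWord.2 ⟨j, .inr ⟨s, h⟩⟩)
      · simp only [Fin.cons_zero, Fin.cons_succ]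
        exact fun h => hwu s _ h (mem_forestWord.2 ⟨i, .inl rfl⟩)
      · simpa only [Fin.cons_succ] using hg.head_notMem i j s
    · intro a i s j t
      refine Fin.cases ?_ (fun i => ?_) i <;> refine Fin.cases ?_ (fun j => ?_) j
      · simp only [Fin.cons_zero, true_and]
        exact hww' a s t
      · simp only [Fin.cons_zero, Fin.cons_succ]
        exact fun h h' => absurd (mem_forestWord.2 ⟨j, .inr ⟨t, h'⟩⟩) (hwu s a h)
      · simp only [Fin.cons_zero, Fin.cons_succ]
        exact fun h h' => absurd (mem_forestWord.2 ⟨i, .inr ⟨s, h⟩⟩) (hwu t a h')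
      · simp only [Fin.cons_succ, Fin.succ_inj]
        exact hg.disj a i s j t
    · exact Fin.cases (by simpa using hlt) (by simpa using hg.head_lt)
    · refine Fin.cases (fun s => ?_) (by simpa using hg.mem_words)
      simp only [Fin.cons_zero]
      refine mem_words_toFinset.2 ⟨fun a ha => ?_, hav.sublist ?_⟩
      · have hne : a ≠ b := fun h => hw s (h ▸ ha)
        have := hc a (List.mem_append_left _ (mem_blockWord.2 (.inr ⟨s, ha⟩)))
        rw [List.count_append, List.count_eq_zero_of_not_mem (hwu s a ha), add_zero,
          count_blockWord_of_ne hne, Finset.sum_eq_single s] at this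
        · exact this
        · exact fun t _ hts => List.count_eq_zero_of_not_mem fun h => hts (hww' a t s h ha)
        · simp
      · refine List.Sublist.trans ?_ (List.sublist_append_left _ _)
        refine List.Sublist.cons _ ?_
        rw [concatFn_eq _ s]
        refine List.Sublist.trans ?_ ((List.sublist_append_right _ _).trans
          (List.sublist_append_left _ _))
        exact List.sublist_append_left _ _
    · rw [forestWord_succ]
      rfl

/-! ### Blocks -/

lemma decide_ne_of_notMem {l : List ℕ} {a : ℕ} (h : a ∉ l) : ∀ x ∈ l, decide (x ≠ a) = true := by
  intro x hx
  rw [decide_eq_true_eq]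
  rintro rfl
  exact h hx

/-- Together with `exists_block` this characterises blocks by a factorisation of the word, which
replaces the definition by `dropWhile` from here on. -/
lemma block_append_eq {u t v : List ℕ} {a : ℕ} (hu : a ∉ u) (hv : a ∉ v) (h₁ : t.head? = some a)
    (h₂ : t.getLast? = some a) : block (u ++ t ++ v) a = t := by
  have hd : (u ++ t ++ v).dropWhile (· ≠ a) = t ++ v := by
    obtain ⟨t', rfl⟩ : ∃ t', t = a :: t' := by
      cases t with
      | nil => simp at h₁
      | cons b t' => simp at h₁; exact ⟨t', by rw [h₁]⟩
    rw [List.append_assoc, List.dropWhile_append_of_pos]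
    · simp
    · exact decide_ne_of_notMem hu
  obtain ⟨t', rfl⟩ : ∃ t', t = t' ++ [a] := by
    rcases List.eq_nil_or_concat t with rfl | ⟨t', b, rfl⟩
    · simp at h₂
    · simp at h₂
      exact ⟨t', by rw [h₂, List.concat_eq_append]⟩
  rw [block, hd, List.rdropWhile, List.reverse_append, List.dropWhile_append_of_pos]
  · simp
  · exact decide_ne_of_notMem (by simpa using hv)

lemma exists_block {σ : List ℕ} {a : ℕ} (ha : a ∈ σ) :
    ∃ u v, σ = u ++ block σ a ++ v ∧ a ∉ u ∧ a ∉ v ∧ (block σ a).head? = some a ∧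
      (block σ a).getLast? = some a := by
  obtain ⟨u, x, rfl, hu⟩ := List.eq_append_cons_of_mem ha
  obtain ⟨v, y, hy, hv⟩ := List.eq_append_cons_of_mem
    (List.mem_reverse.2 (List.mem_cons_self (a := a) (l := x)))
  have h : a :: x = (y.reverse ++ [a]) ++ v.reverse := by
    rw [← List.reverse_reverse (a :: x), hy]
    simp
  have h₁ : (y.reverse ++ [a]).head? = some a := by
    have := congrArg List.head? h
    rw [List.head?_append_of_ne_nil _ (by simp)] at this
    rw [← this]
    rfl
  have h₂ : (y.reverse ++ [a]).getLast? = some a := by simp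
  have hv' : a ∉ v.reverse := by simpa using hv
  rw [h, ← List.append_assoc, block_append_eq hu hv' h₁ h₂]
  exact ⟨u, v.reverse, rfl, hu, hv', h₁, h₂⟩

lemma block_infix {σ : List ℕ} {a : ℕ} (ha : a ∈ σ) : block σ a <:+: σ := by
  obtain ⟨u, v, h, -⟩ := exists_block ha
  exact ⟨u, v, h.symm⟩

lemma mem_block_self {σ : List ℕ} {a : ℕ} (ha : a ∈ σ) : a ∈ block σ a := by
  obtain ⟨u, v, -, -, -, h, -⟩ := exists_block ha
  exact List.mem_of_head? h

lemma block_eq_nil {σ : List ℕ} {a : ℕ} (ha : a ∉ σ) : block σ a = [] := by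
  rw [block, List.dropWhile_eq_nil_iff.2]
  · simp
  · exact decide_ne_of_notMem ha

lemma BlockSub.mem_block {σ : List ℕ} {a c : ℕ} (h : BlockSub σ a c) : a ∈ block σ c :=
  h.2.2.subset (mem_block_self h.1)

lemma BlockSub.right_mem {σ : List ℕ} {a c : ℕ} (h : BlockSub σ a c) : c ∈ σ := by
  by_contra hc
  have := h.mem_block
  rw [block_eq_nil hc] at this
  simp at this

/-- Blocks of equal length, one inside the other, would coincide and so start with the same letter.
-/
lemma BlockSub.length_lt {σ : List ℕ} {a c : ℕ} (h : BlockSub σ a c) :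
    (block σ a).length < (block σ c).length := by
  refine lt_of_le_of_ne h.2.2.length_le fun he => h.2.1 ?_
  have heq := h.2.2.sublist.eq_of_length he
  obtain ⟨-, -, -, -, -, h1, -⟩ := exists_block h.1
  obtain ⟨-, -, -, -, -, h2, -⟩ := exists_block h.right_mem
  rw [heq, h2] at h1
  exact (Option.some.inj h1).symm

lemma IsLevel.mem {σ : List ℕ} {ℓ a : ℕ} (h : IsLevel σ ℓ a) : a ∈ σ := by
  match ℓ, h with
  | 1, h => exact h.1
  | _ + 2, ⟨_, _, _, h, _⟩ => exact h.1

lemma IsLevel.not_isLevelOne {σ : List ℕ} {ℓ a : ℕ} (h : IsLevel σ (ℓ + 2) a) :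
    ¬ IsLevelOne σ a := by
  obtain ⟨j, hj, _, hs, _⟩ := h
  exact fun h1 => h1.2 j hj hs

/-- Blocks shrink strictly with each level. This bounds the levels that occur, which makes the
product over all levels finite. -/
lemma IsLevel.le_length {σ : List ℕ} {ℓ a : ℕ} (h : IsLevel σ ℓ a) :
    (block σ a).length + ℓ ≤ σ.length + 1 := by
  match ℓ, h with
  | 1, h => have := (block_infix h.1).length_le; omega
  | ℓ + 2, ⟨j, _, hl, hs, _⟩ =>
    have := hl.le_length
    have := hs.length_lt
    omega

lemma not_isLevel_of_length_lt {σ : List ℕ} {ℓ a : ℕ} (h : σ.length < ℓ) : ¬ IsLevel σ ℓ a := by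
  intro hl
  have h1 := hl.le_length
  have := List.length_pos_of_mem (mem_block_self hl.mem)
  omega

/-! ### Segments -/

/-- `w` is a segment of `σ` whose letters do not occur elsewhere in `σ`. -/
def IsSegment (w σ : List ℕ) : Prop := ∃ u v, σ = u ++ w ++ v ∧ ∀ a ∈ w, a ∉ u ∧ a ∉ v

namespace IsSegment

variable {w σ : List ℕ}

lemma subset (h : IsSegment w σ) {a : ℕ} (ha : a ∈ w) : a ∈ σ := by
  obtain ⟨u, v, rfl, -⟩ := h
  simp [ha]

/-- Every occurrence of `a` is inside the segment, so the text around it is invisible to the block.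
The locality of containment, types and occurrences rests on this. -/
lemma block_eq (h : IsSegment w σ) {a : ℕ} (ha : a ∈ w) : block σ a = block w a := by
  obtain ⟨u, v, rfl, hw⟩ := h
  obtain ⟨u', v', h, hu, hv, h₁, h₂⟩ := exists_block ha
  have : u ++ w ++ v = (u ++ u') ++ block w a ++ (v' ++ v) := by
    conv_lhs => rw [h]
    simp
  rw [this, block_append_eq _ _ h₁ h₂]
  · simp [hu, (hw a ha).1]
  · simp [hv, (hw a ha).2]

lemma blockInterior_eq (h : IsSegment w σ) {a : ℕ} (ha : a ∈ w) :
    blockInterior σ a = blockInterior w a := by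
  rw [blockInterior, h.block_eq ha, blockInterior]

lemma blockSub_iff (h : IsSegment w σ) {a c : ℕ} (hc : c ∈ w) :
    BlockSub σ a c ↔ BlockSub w a c := by
  constructor
  · intro hs
    have ha := hs.mem_block
    rw [h.block_eq hc] at ha
    have ha := (block_infix hc).subset ha
    have h3 := hs.2.2
    rw [h.block_eq hc, h.block_eq ha] at h3
    exact ⟨ha, hs.2.1, h3⟩
  · intro hs
    refine ⟨h.subset hs.1, hs.2.1, ?_⟩
    rw [h.block_eq hc, h.block_eq hs.1]
    exact hs.2.2

lemma count_takeWhile (h : IsSegment w σ) {a c : ℕ} (ha : a ∈ w) (hc : c ∈ w) :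
    (σ.takeWhile (· ≠ a)).count c = (w.takeWhile (· ≠ a)).count c := by
  obtain ⟨u, v, rfl, hw⟩ := h
  obtain ⟨x, y, rfl, hx⟩ := List.eq_append_cons_of_mem ha
  have h1 := decide_ne_of_notMem hx
  have h2 := decide_ne_of_notMem (hw a ha).1
  rw [List.append_assoc, List.append_assoc, List.takeWhile_append_of_pos h2,
    List.takeWhile_append_of_pos h1, List.takeWhile_append_of_pos h1, List.count_append,
    List.count_eq_zero_of_not_mem (hw c hc).1]
  simp

/-- Passing from `w` to `σ` shifts all positions by the same constant, which affects neither their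
order nor adjacency. -/
lemma isBlockOcc_iff (h : IsSegment w σ) {sib sib' : ℕ → ℕ → Prop} {p : PermPattern}
    {b : Fin p.len → ℕ} (hb : ∀ a, b a ∈ w) (hs : ∀ a c, sib (b a) (b c) ↔ sib' (b a) (b c)) :
    IsBlockOcc sib σ p b ↔ IsBlockOcc sib' w p b := by
  have hidx : ∃ N, ∀ a ∈ w, σ.idxOf a = N + w.idxOf a := by
    obtain ⟨u, v, rfl, hw⟩ := h
    refine ⟨u.length, fun a ha => ?_⟩
    rw [List.append_assoc, List.idxOf_append_of_notMem (hw a ha).1, List.idxOf_append_of_mem ha]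
  obtain ⟨N, hN⟩ := hidx
  have h1 : StrictMono (fun a => σ.idxOf (b a)) ↔ StrictMono (fun a => w.idxOf (b a)) := by
    simp only [StrictMono, hN _ (hb _), add_lt_add_iff_left]
  rw [IsBlockOcc, h1, IsBlockOcc]
  simp only [hs, hN _ (hb _), h.block_eq (hb _), add_assoc, add_right_inj, hb,
    h.subset (hb _)]

end IsSegment

lemma isSegment_concatFn {m : ℕ} {τ : Fin m → List ℕ}
    (h : ∀ a i j, a ∈ τ i → a ∈ τ j → i = j) (i : Fin m) : IsSegment (τ i) (concatFn τ) := by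
  refine ⟨_, _, concatFn_eq τ i, fun a ha => ⟨fun h' => ?_, fun h' => ?_⟩⟩
  · obtain ⟨j, hj, haj⟩ := mem_prefixFn.1 h'
    obtain rfl := h a i j ha haj
    exact lt_irrefl _ hj
  · obtain ⟨j, hj, haj⟩ := mem_suffixFn.1 h'
    obtain rfl := h a i j ha haj
    omega

lemma IsSegment.trans {w σ τ : List ℕ} (h : IsSegment w σ) (h' : IsSegment σ τ) :
    IsSegment w τ := by
  obtain ⟨u, v, rfl, h⟩ := h
  obtain ⟨u', v', rfl, h'⟩ := h'
  refine ⟨u' ++ u, v ++ v', by simp, fun a ha => ?_⟩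
  have := h a ha
  have := h' a (by simp [ha])
  simp [*]

lemma isSegment_blockWord {r : ℕ} {b : ℕ} {w : Fin r → List ℕ} (hb : ∀ s, b ∉ w s)
    (h : ∀ a s t, a ∈ w s → a ∈ w t → s = t) (s : Fin r) : IsSegment (w s) (blockWord b w) := by
  refine ⟨_, _, blockWord_eq b w s, fun a ha => ?_⟩
  have hne : a ≠ b := fun h => hb s (h ▸ ha)
  simp only [List.mem_cons, mem_prefixFn, mem_suffixFn, List.mem_append, List.not_mem_nil,
    or_false, hne, false_or]
  refine ⟨?_, ?_⟩
  · rintro ⟨t, ht, hat⟩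
    obtain rfl := h a s t ha hat
    exact lt_irrefl _ ht
  · rintro ⟨t, ht, hat⟩
    obtain rfl := h a s t ha hat
    omega

/-- Needed because the interior of a level 1 block is the concatenation of its words with the head
removed, whereas levels are to be computed in each word separately. -/
lemma isLevelOne_concatFn {m : ℕ} {τ : Fin m → List ℕ}
    (h : ∀ a i j, a ∈ τ i → a ∈ τ j → i = j) {a : ℕ} :
    IsLevelOne (concatFn τ) a ↔ ∃ i, IsLevelOne (τ i) a := by
  have hseg := isSegment_concatFn h
  constructor
  · rintro ⟨h1, h2⟩
    obtain ⟨i, hi⟩ := mem_concatFn.1 h1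
    exact ⟨i, hi, fun j hj hs => h2 j ((hseg i).subset hj) (((hseg i).blockSub_iff hj).2 hs)⟩
  · rintro ⟨i, h1, h2⟩
    refine ⟨(hseg i).subset h1, fun j hj hs => ?_⟩
    obtain ⟨i', hi'⟩ := mem_concatFn.1 hj
    have hs := ((hseg i').blockSub_iff hi').1 hs
    obtain rfl := h a i i' h1 hs.1
    exact h2 j hi' hs

lemma head?_blockWord {r : ℕ} (b : ℕ) (w : Fin r → List ℕ) : (blockWord b w).head? = some b := rfl

lemma getLast?_blockWord {r : ℕ} (b : ℕ) (w : Fin r → List ℕ) :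
    (blockWord b w).getLast? = some b := by
  cases r with
  | zero => simp [blockWord, concatFn_zero]
  | succ r =>
    rw [blockWord, concatFn_eq _ (Fin.last r)]
    have : suffixFn (fun s => w s ++ [b]) (Fin.last r + 1) = [] := by
      refine List.eq_nil_iff_forall_not_mem.2 fun a ha => ?_
      obtain ⟨j, hj, -⟩ := mem_suffixFn.1 ha
      have := j.2
      simp at hj
      omega
    rw [this, List.append_nil, ← List.append_assoc, ← List.cons_append, List.getLast?_append]
    simp

/-! ### Levels, parents and types in a forest -/

namespace IsForest

variable {m r : ℕ} {g : Fin m → ℕ × (Fin r → List ℕ)}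

lemma eq_of_mem_blockWord (hg : IsForest g) {a : ℕ} {i j : Fin m}
    (hi : a ∈ blockWord (g i).1 (g i).2) (hj : a ∈ blockWord (g j).1 (g j).2) : i = j := by
  rw [mem_blockWord] at hi hj
  rcases hi with rfl | ⟨s, hs⟩ <;> rcases hj with hj | ⟨t, ht⟩
  · exact hg.head_inj _ _ hj
  · exact absurd ht (hg.head_notMem _ _ _)
  · exact absurd (hj ▸ hs) (hg.head_notMem _ _ _)
  · exact (hg.disj _ _ _ _ _ hs ht).1

lemma head_mem (g : Fin m → ℕ × (Fin r → List ℕ)) (i : Fin m) : (g i).1 ∈ forestWord g :=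
  mem_forestWord.2 ⟨i, .inl rfl⟩

lemma isSegment_block (hg : IsForest g) (i : Fin m) :
    IsSegment (blockWord (g i).1 (g i).2) (forestWord g) :=
  isSegment_concatFn (τ := fun i => blockWord (g i).1 (g i).2)
    (fun _ _ _ h h' => hg.eq_of_mem_blockWord h h') i

lemma isSegment_sub (hg : IsForest g) (i : Fin m) (s : Fin r) :
    IsSegment ((g i).2 s) (blockWord (g i).1 (g i).2) :=
  isSegment_blockWord (fun _ => hg.head_notMem _ _ _)
    (fun _ _ _ h h' => (hg.disj _ _ _ _ _ h h').2) s

lemma isSegment (hg : IsForest g) (i : Fin m) (s : Fin r) :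
    IsSegment ((g i).2 s) (forestWord g) := (hg.isSegment_sub i s).trans (hg.isSegment_block i)

lemma block_head (hg : IsForest g) (i : Fin m) :
    block (forestWord g) (g i).1 = blockWord (g i).1 (g i).2 := by
  rw [(hg.isSegment_block i).block_eq (mem_blockWord.2 (.inl rfl))]
  have := block_append_eq (u := []) (v := []) (by simp) (by simp)
    (head?_blockWord (g i).1 (g i).2) (getLast?_blockWord _ _)
  simpa using this

lemma blockInterior_head (hg : IsForest g) (i : Fin m) :
    blockInterior (forestWord g) (g i).1 = concatFn (g i).2 := by
  rw [blockInterior, hg.block_head, blockWord, concatFn, concatFn]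
  simp only [ne_eq, decide_not, List.filter_cons, decide_true,
    Bool.not_true, Bool.false_eq_true, if_false, List.filter_flatten, List.map_ofFn]
  congr 2
  funext s
  rw [Function.comp_apply, List.filter_append]
  simp only [List.filter_cons, decide_true, Bool.not_true, Bool.false_eq_true, if_false,
    List.filter_nil, List.append_nil, List.filter_eq_self]
  simpa using decide_ne_of_notMem (hg.head_notMem i i s)

lemma blockSub_head (hg : IsForest g) {i : Fin m} {a : ℕ} :
    BlockSub (forestWord g) a (g i).1 ↔ ∃ s, a ∈ (g i).2 s := by
  constructor
  · intro h
    have := h.mem_block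
    rw [hg.block_head, mem_blockWord] at this
    exact this.resolve_left h.2.1
  · rintro ⟨s, hs⟩
    refine ⟨(hg.isSegment i s).subset hs, fun h => hg.head_notMem i i s (h ▸ hs), ?_⟩
    rw [(hg.isSegment i s).block_eq hs, hg.block_head]
    obtain ⟨u, v, h, -⟩ := hg.isSegment_sub i s
    exact (block_infix hs).trans ⟨u, v, h.symm⟩

/-- Every other letter lies in the block of some head, while a head occurs in none of the words
enclosed by heads. -/
lemma isLevel_one (hg : IsForest g) {a : ℕ} :
    IsLevel (forestWord g) 1 a ↔ ∃ i, a = (g i).1 := by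
  constructor
  · rintro ⟨h1, h2⟩
    obtain ⟨i, rfl | ⟨s, hs⟩⟩ := mem_forestWord.1 h1
    · exact ⟨i, rfl⟩
    · exact absurd (hg.blockSub_head.2 ⟨s, hs⟩) (h2 _ (head_mem g i))
  · rintro ⟨i, rfl⟩
    refine ⟨head_mem g i, fun j hj hs => ?_⟩
    obtain ⟨i', rfl | ⟨s, hs'⟩⟩ := mem_forestWord.1 hj
    · obtain ⟨s, hs⟩ := hg.blockSub_head.1 hs
      exact hg.head_notMem _ _ _ hs
    · exact hg.head_notMem _ _ _ (((hg.isSegment i' s).blockSub_iff hs').1 hs).1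

/-- Level 2 is computed in the interior of a head; for deeper levels the enclosing block already
lies in some `(g i).2 s`, and everything is local to that segment. -/
lemma isLevel_add_two (hg : IsForest g) {ℓ a : ℕ} :
    IsLevel (forestWord g) (ℓ + 2) a ↔ ∃ i s, IsLevel ((g i).2 s) (ℓ + 1) a := by
  induction ℓ generalizing a with
  | zero =>
    have hl : ∀ i, IsLevelOne (concatFn (g i).2) a ↔ ∃ s, IsLevelOne ((g i).2 s) a := fun i =>
      isLevelOne_concatFn fun _ _ _ h h' => (hg.disj _ _ _ _ _ h h').2
    constructor
    · rintro ⟨j, -, hj, hs, h1⟩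
      obtain ⟨i, rfl⟩ := hg.isLevel_one.1 hj
      rw [hg.blockInterior_head, hl] at h1
      exact ⟨i, h1⟩
    · rintro ⟨i, s, h⟩
      refine ⟨(g i).1, head_mem g i, hg.isLevel_one.2 ⟨i, rfl⟩, hg.blockSub_head.2 ⟨s, h.mem⟩, ?_⟩
      rw [hg.blockInterior_head, hl]
      exact ⟨s, h⟩
  | succ ℓ ih =>
    constructor
    · rintro ⟨j, -, hj, hs, h1⟩
      obtain ⟨i, s, hj⟩ := ih.1 hj
      have hseg := hg.isSegment i s
      rw [hseg.blockInterior_eq hj.mem] at h1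
      exact ⟨i, s, j, hj.mem, hj, (hseg.blockSub_iff hj.mem).1 hs, h1⟩
    · rintro ⟨i, s, j, hjm, hj, hs, h1⟩
      have hseg := hg.isSegment i s
      rw [← hseg.blockInterior_eq hjm] at h1
      exact ⟨j, hseg.subset hjm, ih.2 ⟨i, s, hj⟩, (hseg.blockSub_iff hjm).2 hs, h1⟩

/-- For `ℓ = 0` both sides are false: there is no level 0, and `a` is not a head. -/
lemma isLevel_sub (hg : IsForest g) {ℓ a : ℕ} {i : Fin m} {s : Fin r} (ha : a ∈ (g i).2 s) :
    IsLevel (forestWord g) (ℓ + 1) a ↔ IsLevel ((g i).2 s) ℓ a := by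
  cases ℓ with
  | zero =>
    rw [hg.isLevel_one]
    simp only [IsLevel, iff_false, not_exists]
    rintro j rfl
    exact hg.head_notMem _ _ _ ha
  | succ ℓ =>
    rw [hg.isLevel_add_two]
    refine ⟨fun ⟨j, t, h⟩ => ?_, fun h => ⟨i, s, h⟩⟩
    obtain ⟨rfl, rfl⟩ := hg.disj a i s j t ha h.mem
    exact h

lemma isParent_head (hg : IsForest g) {a : ℕ} {i : Fin m} :
    IsParent (forestWord g) (g i).1 a ↔ ∃ s, IsLevel ((g i).2 s) 1 a := by
  constructor
  · rintro ⟨hs, ℓ, h1, h2⟩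
    obtain ⟨s, hs⟩ := hg.blockSub_head.1 hs
    refine ⟨s, ?_⟩
    rw [hg.isLevel_sub hs] at h2
    match ℓ, h1 with
    | 1, _ => exact h2
    | ℓ + 2, h1 =>
      obtain ⟨j, t, h⟩ := hg.isLevel_add_two.1 h1
      exact absurd h.mem (hg.head_notMem _ _ _)
  · rintro ⟨s, h⟩
    exact ⟨hg.blockSub_head.2 ⟨s, h.mem⟩, 1, hg.isLevel_one.2 ⟨i, rfl⟩, (hg.isLevel_sub h.mem).2 h⟩

lemma isParent_sub (hg : IsForest g) {a h : ℕ} {i : Fin m} {s : Fin r} (hh : h ∈ (g i).2 s) :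
    IsParent (forestWord g) h a ↔ IsParent ((g i).2 s) h a := by
  rw [IsParent, (hg.isSegment i s).blockSub_iff hh, IsParent]
  refine and_congr_right fun hs => ?_
  constructor
  · rintro ⟨ℓ, h1, h2⟩
    match ℓ, h1, h2 with
    | ℓ + 1, h1, h2 => exact ⟨ℓ, (hg.isLevel_sub hh).1 h1, (hg.isLevel_sub hs.1).1 h2⟩
  · rintro ⟨ℓ, h1, h2⟩
    exact ⟨ℓ + 1, (hg.isLevel_sub hh).2 h1, (hg.isLevel_sub hs.1).2 h2⟩

/-- A parent of a letter of `(g i).2 s` is the head of its level 1 block or lies in the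
same word. -/
lemma isParent_cases (hg : IsForest g) {a h : ℕ} {i : Fin m} {s : Fin r} (ha : a ∈ (g i).2 s)
    (hp : IsParent (forestWord g) h a) :
    (h = (g i).1 ∧ IsLevel ((g i).2 s) 1 a) ∨
      (h ∈ (g i).2 s ∧ IsParent ((g i).2 s) h a ∧ ¬ IsLevelOne ((g i).2 s) a) := by
  obtain ⟨j, rfl | ⟨t, ht⟩⟩ := mem_forestWord.1 hp.1.right_mem
  · obtain ⟨t, h⟩ := hg.isParent_head.1 hp
    obtain ⟨rfl, rfl⟩ := hg.disj a i s j t ha h.mem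
    exact .inl ⟨rfl, h⟩
  · have hp := (hg.isParent_sub ht).1 hp
    obtain ⟨rfl, rfl⟩ := hg.disj a i s j t ha hp.1.1
    exact .inr ⟨ht, hp, fun h => h.2 _ ht hp.1⟩

/-- The head occurs once at the start of the block and once after each of the `s` words preceding
`(g i).2 s`. -/
lemma count_takeWhile_head (hg : IsForest g) {a : ℕ} {i : Fin m} {s : Fin r}
    (ha : a ∈ (g i).2 s) :
    ((forestWord g).takeWhile (· ≠ a)).count (g i).1 = s + 1 := by
  have hb : (g i).1 ∈ blockWord (g i).1 (g i).2 := mem_blockWord.2 (.inl rfl)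
  have ha' : a ∈ blockWord (g i).1 (g i).2 := mem_blockWord.2 (.inr ⟨s, ha⟩)
  rw [(hg.isSegment_block i).count_takeWhile ha' hb]
  obtain ⟨x, y, hxy, hx⟩ := List.eq_append_cons_of_mem ha
  have hne : a ≠ (g i).1 := fun h => hg.head_notMem i i s (h ▸ ha)
  have hu : a ∉ (g i).1 :: prefixFn (fun s => (g i).2 s ++ [(g i).1]) s := by
    simp only [List.mem_cons, mem_prefixFn, List.mem_append, List.not_mem_nil,
      or_false, hne, false_or]
    rintro ⟨t, ht, hat⟩
    obtain ⟨-, rfl⟩ := hg.disj a i s i t ha hat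
    exact lt_irrefl _ ht
  have hcount : ∀ n ≤ r, (prefixFn (fun s => (g i).2 s ++ [(g i).1]) n).count (g i).1 = n := by
    intro n hn
    induction n with
    | zero => simp [prefixFn_zero]
    | succ n ih =>
      have := prefixFn_succ (fun s => (g i).2 s ++ [(g i).1]) ⟨n, hn⟩
      simp only at this
      rw [this, List.count_append, ih (by omega), List.count_append,
        List.count_eq_zero_of_not_mem (hg.head_notMem _ _ _)]
      simp
  have h1 := decide_ne_of_notMem hu
  have h2 := decide_ne_of_notMem hx
  have h3 : (g i).1 ∉ x := fun h => hg.head_notMem i i s (by rw [hxy]; simp [h])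
  rw [blockWord_eq _ _ s, List.append_assoc, List.takeWhile_append_of_pos h1, hxy,
    List.append_assoc, List.takeWhile_append_of_pos h2, List.count_append, List.count_append,
    List.count_cons_self, hcount _ s.2.le, List.count_eq_zero_of_not_mem h3]
  simp

lemma hasType_of_isLevel_one (hg : IsForest g) {a t : ℕ} {i : Fin m} {s : Fin r}
    (ha : IsLevel ((g i).2 s) 1 a) : HasType (forestWord g) a t ↔ t = s + 1 := by
  constructor
  · rintro ⟨h, hp, rfl⟩
    rcases hg.isParent_cases ha.mem hp with ⟨rfl, -⟩ | ⟨-, -, h⟩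
    · exact hg.count_takeWhile_head ha.mem
    · exact absurd ha h
  · rintro rfl
    exact ⟨(g i).1, hg.isParent_head.2 ⟨s, ha⟩, hg.count_takeWhile_head ha.mem⟩

/-- Below level 1 of the word the parent lies in the same word, so both the parent and the count of
its preceding occurrences are local. -/
lemma hasType_sub (hg : IsForest g) {a t : ℕ} {i : Fin m} {s : Fin r} (hm : a ∈ (g i).2 s)
    (ha : ¬ IsLevelOne ((g i).2 s) a) :
    HasType (forestWord g) a t ↔ HasType ((g i).2 s) a t := by
  constructor
  · rintro ⟨h, hp, rfl⟩
    rcases hg.isParent_cases hm hp with ⟨rfl, h⟩ | ⟨hh, hp, -⟩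
    · exact absurd h ha
    · exact ⟨h, hp, ((hg.isSegment i s).count_takeWhile hm hh).symm⟩
  · rintro ⟨h, hp, rfl⟩
    have hh := hp.1.right_mem
    exact ⟨h, (hg.isParent_sub hh).2 hp, (hg.isSegment i s).count_takeWhile hm hh⟩

lemma isLevel_hasType_two (hg : IsForest g) {a : ℕ} {s : Fin r} :
    IsLevel (forestWord g) 2 a ∧ HasType (forestWord g) a (s + 1) ↔
      ∃ i, IsLevel ((g i).2 s) 1 a := by
  constructor
  · rintro ⟨h, ht⟩
    obtain ⟨i, s', h⟩ := hg.isLevel_add_two.1 h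
    rw [hg.hasType_of_isLevel_one h, Nat.add_right_cancel_iff, Fin.val_inj] at ht
    subst ht
    exact ⟨i, h⟩
  · rintro ⟨i, h⟩
    exact ⟨hg.isLevel_add_two.2 ⟨i, s, h⟩, (hg.hasType_of_isLevel_one h).2 rfl⟩

lemma isLevel_hasType_add_three (hg : IsForest g) {ℓ a t : ℕ} :
    IsLevel (forestWord g) (ℓ + 3) a ∧ HasType (forestWord g) a t ↔
      ∃ i s, IsLevel ((g i).2 s) (ℓ + 2) a ∧ HasType ((g i).2 s) a t := by
  constructor
  · rintro ⟨h, ht⟩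
    obtain ⟨i, s, h⟩ := hg.isLevel_add_two.1 h
    rw [hg.hasType_sub h.mem h.not_isLevelOne] at ht
    exact ⟨i, s, h, ht⟩
  · rintro ⟨i, s, h, ht⟩
    exact ⟨hg.isLevel_add_two.2 ⟨i, s, h⟩, (hg.hasType_sub h.mem h.not_isLevelOne).2 ht⟩

end IsForest

/-! ### Statistics of a forest -/

lemma ncard_iUnion_eq_sum {ι α : Type*} [Fintype ι] {U : ι → Set α} (hfin : ∀ i, (U i).Finite)
    (hdisj : ∀ x i j, x ∈ U i → x ∈ U j → i = j) : (⋃ i, U i).ncard = ∑ i, (U i).ncard := by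
  rw [Set.ncard_iUnion_of_finite hfin, finsum_eq_sum_of_fintype]
  intro i j hij
  exact Set.disjoint_left.2 fun x hi hj => hij (hdisj x i j hi hj)

lemma finite_blockOcc {sib : ℕ → ℕ → Prop} {σ : List ℕ} {p : PermPattern}
    {P : (Fin p.len → ℕ) → Prop} : {b | IsBlockOcc sib σ p b ∧ P b}.Finite := by
  refine (Set.Finite.pi' (t := fun _ : Fin p.len => {a | a ∈ σ}) fun _ => ?_).subset
    fun b hb => hb.1.2.1
  exact (List.finite_toSet σ)

namespace IsForest

variable {m r : ℕ} {g : Fin m → ℕ × (Fin r → List ℕ)}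

lemma numBlocks_one (hg : IsForest g) : numBlocks (forestWord g) 1 = m := by
  have : {a | IsLevel (forestWord g) 1 a} = Set.range fun i => (g i).1 := by
    ext a
    simp [hg.isLevel_one, eq_comm]
  rw [numBlocks, this, ← Set.image_univ, Set.ncard_image_of_injective _ fun i j => hg.head_inj i j]
  simp

lemma numBlocksOfType_two (hg : IsForest g) (s : Fin r) :
    numBlocksOfType (forestWord g) 2 (s + 1) = ∑ i, numBlocks ((g i).2 s) 1 := by
  simp only [numBlocksOfType, hg.isLevel_hasType_two, numBlocks]
  rw [Set.ofPred_exists, ncard_iUnion_eq_sum]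
  · exact fun i => (List.finite_toSet ((g i).2 s)).subset fun a ha => IsLevel.mem ha
  · exact fun a i j hi hj => (hg.disj a i s j s hi.mem hj.mem).1

lemma numBlocksOfType_add_three (hg : IsForest g) (ℓ t : ℕ) :
    numBlocksOfType (forestWord g) (ℓ + 3) t =
      ∑ i, ∑ s, numBlocksOfType ((g i).2 s) (ℓ + 2) t := by
  simp only [numBlocksOfType, hg.isLevel_hasType_add_three]
  rw [← Fintype.sum_prod_type', ← ncard_iUnion_eq_sum]
  · congr 1
    ext a
    simp
  · exact fun i => (List.finite_toSet ((g i.1).2 i.2)).subset fun a ha => IsLevel.mem ha.1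
  · exact fun a i j hi hj => Prod.ext_iff.2 (hg.disj a _ _ _ _ hi.1.mem hj.1.mem)

/-- Equal level and type do not make blocks siblings, as they may sit under different heads; a
common parent forces a common index `i`. -/
lemma kSibling_two (hg : IsForest g) {a c : ℕ} {s : Fin r}
    (ha : IsLevel (forestWord g) 2 a ∧ HasType (forestWord g) a (s + 1))
    (hc : IsLevel (forestWord g) 2 c ∧ HasType (forestWord g) c (s + 1)) :
    KSibling (forestWord g) a c ↔
      ∃ i, IsLevel ((g i).2 s) 1 a ∧ IsLevel ((g i).2 s) 1 c := by
  constructor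
  · rintro (h | ⟨⟨h, h1, h2⟩, -⟩)
    · exact absurd h.1 ha.1.not_isLevelOne
    · obtain ⟨i, ha'⟩ := hg.isLevel_hasType_two.1 ha
      obtain ⟨j, hc'⟩ := hg.isLevel_hasType_two.1 hc
      rcases hg.isParent_cases ha'.mem h1 with ⟨rfl, -⟩ | ⟨-, -, h⟩
      · obtain ⟨t, ht⟩ := hg.isParent_head.1 h2
        obtain ⟨rfl, rfl⟩ := hg.disj c _ _ _ _ hc'.mem ht.mem
        exact ⟨_, ha', hc'⟩
      · exact absurd ha' h
  · rintro ⟨i, h1, h2⟩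
    exact .inr ⟨⟨(g i).1, hg.isParent_head.2 ⟨s, h1⟩, hg.isParent_head.2 ⟨s, h2⟩⟩,
      s + 1, ha.2, hc.2⟩

/-- The condition on `c` ranges over all words because it is only a consequence of being siblings
that `c` lies in the same word as `a`. -/
lemma kSibling_sub (hg : IsForest g) {a c : ℕ} {i : Fin m} {s : Fin r}
    (ha : a ∈ (g i).2 s) (ha1 : ¬ IsLevelOne ((g i).2 s) a)
    (hc1 : ∀ j t, c ∈ (g j).2 t → ¬ IsLevelOne ((g j).2 t) c) :
    KSibling (forestWord g) a c ↔ KSibling ((g i).2 s) a c := by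
  constructor
  · rintro (h | ⟨⟨h, h1, h2⟩, t, ht, ht'⟩)
    · obtain ⟨j, rfl⟩ := hg.isLevel_one.1 h.1
      exact absurd ha (hg.head_notMem _ _ _)
    · rcases hg.isParent_cases ha h1 with ⟨-, h⟩ | ⟨hh, h1, -⟩
      · exact absurd h ha1
      · have h2 := (hg.isParent_sub hh).1 h2
        have hc := h2.1.1
        exact .inr ⟨⟨h, h1, h2⟩, t, (hg.hasType_sub ha ha1).1 ht,
          (hg.hasType_sub hc (hc1 _ _ hc)).1 ht'⟩
  · rintro (h | ⟨⟨h, h1, h2⟩, t, ht, ht'⟩)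
    · exact absurd h.1 ha1
    · have hh := h1.1.right_mem
      have hc := h2.1.1
      exact .inr ⟨⟨h, (hg.isParent_sub hh).2 h1, (hg.isParent_sub hh).2 h2⟩, t,
        (hg.hasType_sub ha ha1).2 ht, (hg.hasType_sub hc (hc1 _ _ hc)).2 ht'⟩

/-- The blocks of an occurrence are siblings, so they all lie in one of the words `(g i).2 s`;
occurrences for different `i` are distinct, as a pattern that occurs is nonempty. -/
lemma kOcc_two (hg : IsForest g) (s : Fin r) (p : PermPattern) :
    kOcc (forestWord g) 2 (s + 1) p = ∑ i, kOccOne ((g i).2 s) p := by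
  simp only [kOcc, kOccOne]
  rw [← ncard_iUnion_eq_sum]
  · congr 1
    ext b
    simp only [Set.mem_ofPred_eq, Set.mem_iUnion]
    constructor
    · rintro ⟨hb, hl⟩
      -- Entry `0` exists since the pattern has positive length; comparing every entry with it pins
      -- down the index `i`.
      have hsib := fun a => (hg.kSibling_two (hl ⟨0, hb.1⟩) (hl a)).1 (hb.2.2.1 ⟨0, hb.1⟩ a)
      obtain ⟨i, h0, -⟩ := hsib ⟨0, hb.1⟩
      have hl' : ∀ a, IsLevel ((g i).2 s) 1 (b a) := by
        intro a
        obtain ⟨j, h1, h2⟩ := hsib a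
        obtain ⟨rfl, -⟩ := hg.disj _ _ _ _ _ h0.mem h1.mem
        exact h2
      refine ⟨i, ((hg.isSegment i s).isBlockOcc_iff (fun a => (hl' a).mem) fun a c => ?_).1 hb, hl'⟩
      rw [hg.kSibling_two (hl a) (hl c)]
      exact ⟨fun _ => .inl ⟨hl' a, hl' c⟩, fun _ => ⟨i, hl' a, hl' c⟩⟩
    · rintro ⟨i, hb, hl'⟩
      have hl := fun a => hg.isLevel_hasType_two.2 ⟨i, hl' a⟩
      refine ⟨((hg.isSegment i s).isBlockOcc_iff (fun a => (hl' a).mem) fun a c => ?_).2 hb, hl⟩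
      rw [hg.kSibling_two (hl a) (hl c)]
      exact ⟨fun _ => .inl ⟨hl' a, hl' c⟩, fun _ => ⟨i, hl' a, hl' c⟩⟩
  · exact fun i => finite_blockOcc
  · exact fun b i j hi hj => (hg.disj _ _ _ _ _ (hi.2 ⟨0, hi.1.1⟩).mem (hj.2 ⟨0, hi.1.1⟩).mem).1

lemma kOcc_add_three (hg : IsForest g) (ℓ t : ℕ) (p : PermPattern) :
    kOcc (forestWord g) (ℓ + 3) t p = ∑ i, ∑ s, kOcc ((g i).2 s) (ℓ + 2) t p := by
  simp only [kOcc]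
  rw [← Fintype.sum_prod_type', ← ncard_iUnion_eq_sum]
  · congr 1
    ext b
    simp only [Set.mem_ofPred_eq, Set.mem_iUnion, Prod.exists]
    constructor
    · rintro ⟨hb, hl⟩
      have hl1 := fun a => hg.isLevel_hasType_add_three.1 (hl a)
      have hl2 : ∀ a j t, b a ∈ (g j).2 t → ¬ IsLevelOne ((g j).2 t) (b a) := by
        intro a j t h
        exact ((hg.isLevel_sub h).1 (hl a).1).not_isLevelOne
      obtain ⟨i, s, h0, -⟩ := hl1 ⟨0, hb.1⟩
      have hsib := fun a => (hg.kSibling_sub h0.mem h0.not_isLevelOne (hl2 a)).1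
        (hb.2.2.1 ⟨0, hb.1⟩ a)
      have hmem : ∀ a, b a ∈ (g i).2 s := by
        intro a
        rcases hsib a with h | ⟨⟨h, -, h2⟩, -⟩
        · exact h.2.mem
        · exact h2.1.1
      refine ⟨i, s, ((hg.isSegment i s).isBlockOcc_iff hmem fun a c =>
        hg.kSibling_sub (hmem a) (hl2 _ _ _ (hmem a)) (hl2 c)).1 hb, fun a => ?_⟩
      obtain ⟨j, t, h⟩ := hl1 a
      obtain ⟨rfl, rfl⟩ := hg.disj _ _ _ _ _ (hmem a) h.1.mem
      exact h
    · rintro ⟨i, s, hb, hl'⟩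
      have hl := fun a => hg.isLevel_hasType_add_three.2 ⟨i, s, hl' a⟩
      have hl2 : ∀ a j t, b a ∈ (g j).2 t → ¬ IsLevelOne ((g j).2 t) (b a) := by
        intro a j t h
        exact ((hg.isLevel_sub h).1 (hl a).1).not_isLevelOne
      have hmem := fun a => (hl' a).1.mem
      exact ⟨((hg.isSegment i s).isBlockOcc_iff hmem fun a c =>
        hg.kSibling_sub (hmem a) (hl2 _ _ _ (hmem a)) (hl2 c)).2 hb, hl⟩
  · exact fun i => finite_blockOcc
  · exact fun b i j hi hj => Prod.ext_iff.2
      (hg.disj _ _ _ _ _ (hi.2 ⟨0, hi.1.1⟩).1.mem (hj.2 ⟨0, hi.1.1⟩).1.mem)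

lemma idxOf_head (hg : IsForest g) (i : Fin m) :
    (forestWord g).idxOf (g i).1 = (prefixFn (fun i => blockWord (g i).1 (g i).2) i).length := by
  have hn : (g i).1 ∉ prefixFn (fun i => blockWord (g i).1 (g i).2) i := by
    intro h
    obtain ⟨j, hj, h⟩ := mem_prefixFn.1 h
    obtain rfl := hg.eq_of_mem_blockWord (mem_blockWord.2 (.inl rfl)) h
    exact lt_irrefl _ hj
  rw [forestWord, concatFn_eq _ i, List.append_assoc, List.idxOf_append_of_notMem hn]
  simp [blockWord]

lemma length_prefixFn_lt (g : Fin m → ℕ × (Fin r → List ℕ)) {n n' : ℕ} (h : n < n')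
    (hm : n' ≤ m) : (prefixFn (fun i => blockWord (g i).1 (g i).2) n).length <
      (prefixFn (fun i => blockWord (g i).1 (g i).2) n').length := by
  induction n' with
  | zero => omega
  | succ n' ih =>
    have := prefixFn_succ (fun i => blockWord (g i).1 (g i).2) ⟨n', hm⟩
    simp only at this
    rw [this, List.length_append, blockWord, List.length_cons]
    rcases Nat.lt_succ_iff_lt_or_eq.1 h with h | rfl
    · have := ih h (by omega)
      omega
    · omega

/-- The head of block `i` stands at the total length of the preceding blocks. These lengths increase
strictly with `i`, so order of positions becomes order of indices, and adjacency of blocks becomes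
consecutiveness of indices. -/
lemma kOccOne_eq (hg : IsForest g) (p : PermPattern) :
    kOccOne (forestWord g) p = {i : Fin p.len → Fin m | p.IsOcc (fun i => (g i).1) i}.ncard := by
  have hlt : ∀ {n n' : ℕ}, n ≤ m → n' ≤ m →
      ((prefixFn (fun i => blockWord (g i).1 (g i).2) n).length <
        (prefixFn (fun i => blockWord (g i).1 (g i).2) n').length ↔ n < n') := by
    intro n n' hn hn'
    refine ⟨fun h => ?_, fun h => length_prefixFn_lt g h hn'⟩
    by_contra hle
    rcases (not_lt.1 hle).lt_or_eq with h' | rfl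
    · have := length_prefixFn_lt g h' hn
      omega
    · omega
  have hinj : Function.Injective fun (i : Fin p.len → Fin m) a => (g (i a)).1 := by
    intro i j h
    funext a
    exact hg.head_inj _ _ (congrFun h a)
  rw [kOccOne, ← Set.ncard_image_of_injective _ hinj]
  have key : ∀ i : Fin p.len → Fin m,
      (IsBlockOcc (KSibling (forestWord g)) (forestWord g) p (fun a => (g (i a)).1) ∧
        ∀ a, IsLevel (forestWord g) 1 (g (i a)).1) ↔ p.IsOcc (fun i => (g i).1) i := by
    intro i
    have hl : ∀ a, IsLevel (forestWord g) 1 (g (i a)).1 := fun a => hg.isLevel_one.2 ⟨_, rfl⟩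
    have hs : ∀ a c, KSibling (forestWord g) (g (i a)).1 (g (i c)).1 :=
      fun a c => .inl ⟨hl a, hl c⟩
    have hlink : ∀ a c : Fin m, (forestWord g).idxOf (g c).1 =
        (forestWord g).idxOf (g a).1 + (block (forestWord g) (g a).1).length ↔
          (c : ℕ) = (a : ℕ) + 1 := by
      intro a c
      rw [hg.idxOf_head, hg.idxOf_head, hg.block_head, ← List.length_append]
      have := prefixFn_succ (fun i => blockWord (g i).1 (g i).2) a
      rw [← this]
      have h1 := hlt c.2.le (show (a : ℕ) + 1 ≤ m from a.2)
      have h2 := hlt (show (a : ℕ) + 1 ≤ m from a.2) c.2.le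
      omega
    have hmono : StrictMono (fun a => (forestWord g).idxOf (g (i a)).1) ↔ StrictMono i := by
      simp only [StrictMono, hg.idxOf_head, hlt (Fin.is_le' ..) (Fin.is_le' ..), Fin.val_fin_lt]
    simp only [IsBlockOcc, PermPattern.IsOcc, hl, hs, hlink, head_mem, implies_true, true_and,
      and_true]
    rw [hmono]
  congr 1
  ext b
  simp only [Set.mem_ofPred_eq, Set.mem_image]
  constructor
  · intro h
    choose i hi using fun a => hg.isLevel_one.1 (h.2 a)
    obtain rfl : b = fun a => (g (i a)).1 := funext hi
    exact ⟨i, (key i).1 h, rfl⟩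
  · rintro ⟨i, hi, rfl⟩
    exact (key i).2 hi

end IsForest

/-! ### The weight of a forest -/

/-- The conditions in the definition of `kStirlingAvoiding`. -/
def AvoidsBlockPatterns {k : ℕ} (A : TupleSeq k (Set PermPattern)) (σ : List ℕ) : Prop :=
  (∀ a ∈ A.head, kOccOne σ a = 0) ∧
    ∀ (i : ℕ) (j : Fin (k - 1)), ∀ a ∈ A.tail i j, kOcc σ (i + 2) (j + 1) a = 0

lemma kOcc_eq_zero {σ : List ℕ} {ℓ t : ℕ} {p : PermPattern} (h : σ.length < ℓ) :
    kOcc σ ℓ t p = 0 := by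
  refine (congrArg Set.ncard (Set.eq_empty_of_forall_notMem fun b hb => ?_)).trans
    (Set.ncard_empty _)
  exact not_isLevel_of_length_lt h (hb.2 ⟨0, hb.1.1⟩).1

lemma numBlocksOfType_eq_zero {σ : List ℕ} {ℓ t : ℕ} (h : σ.length < ℓ) :
    numBlocksOfType σ ℓ t = 0 := by
  refine (congrArg Set.ncard (Set.eq_empty_of_forall_notMem fun a ha => ?_)).trans
    (Set.ncard_empty _)
  exact not_isLevel_of_length_lt h ha.1

section Weight

variable {R : Type*} [CommRing R]

lemma kWeight_eq_prod_range {k : ℕ} (p : TupleSeq k PermPattern) (x y : TupleSeq k R)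
    {σ : List ℕ} {N : ℕ} (hN : σ.length ≤ N) :
    kWeight k p x y σ = x.head ^ kOccOne σ p.head * y.head ^ numBlocks σ 1 *
      ∏ i ∈ Finset.range N, ∏ j : Fin (k - 1),
        x.tail i j ^ kOcc σ (i + 2) (j + 1) (p.tail i j) *
          y.tail i j ^ numBlocksOfType σ (i + 2) (j + 1) := by
  rw [kWeight, finprod_eq_prod_of_mulSupport_subset]
  intro i hi
  simp only [Finset.coe_range, Set.mem_Iio]
  by_contra hle
  refine hi (Finset.prod_eq_one fun j _ => ?_)
  rw [kOcc_eq_zero (by omega), numBlocksOfType_eq_zero (by omega)]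
  simp

open Classical in
/-- The contribution of `σ` to `kStirlingEGF`. -/
noncomputable def avoidingWeight {k : ℕ} (A : TupleSeq k (Set PermPattern))
    (p : TupleSeq k PermPattern) (x y : TupleSeq k R) (σ : List ℕ) : R :=
  if AvoidsBlockPatterns A σ then kWeight k p x y σ else 0

lemma prod_comm_pairs {ι κ α β : Type*} (s : Finset ι) (t : Finset κ) (u : Finset α)
    (v : Finset β) (f : ι → κ → α → β → R) :
    ∏ a ∈ s, ∏ b ∈ t, ∏ c ∈ u, ∏ d ∈ v, f a b c d =
      ∏ c ∈ u, ∏ d ∈ v, ∏ a ∈ s, ∏ b ∈ t, f a b c d := by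
  simp_rw [← Finset.prod_product' s t, ← Finset.prod_product' u v]
  exact Finset.prod_comm

variable {m k : ℕ} {g : Fin m → ℕ × (Fin (k - 1) → List ℕ)}

/-- Occurrence numbers beyond level 1 are sums over the words of the forest, and a sum of natural
numbers vanishes exactly when every summand does. -/
lemma IsForest.avoidsBlockPatterns_iff (hg : IsForest g) (A : TupleSeq k (Set PermPattern)) :
    AvoidsBlockPatterns A (forestWord g) ↔
      (∀ a ∈ A.head, {i : Fin a.len → Fin m | a.IsOcc (fun i => (g i).1) i}.ncard = 0) ∧
        ∀ i s, AvoidsBlockPatterns (A.shift s) ((g i).2 s) := by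
  simp only [AvoidsBlockPatterns, hg.kOccOne_eq, TupleSeq.shift]
  refine and_congr_right fun _ => ⟨fun h i s => ⟨fun a ha => ?_, fun ℓ j a ha => ?_⟩,
    fun h ℓ j a ha => ?_⟩
  · have := h 0 s a ha
    rw [hg.kOcc_two, Finset.sum_eq_zero_iff] at this
    exact this i (Finset.mem_univ _)
  · have := h (ℓ + 1) j a ha
    rw [hg.kOcc_add_three, Finset.sum_eq_zero_iff] at this
    have := this i (Finset.mem_univ _)
    rw [Finset.sum_eq_zero_iff] at this
    exact this s (Finset.mem_univ _)
  · cases ℓ with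
    | zero =>
      rw [hg.kOcc_two]
      exact Finset.sum_eq_zero fun i _ => (h i j).1 a ha
    | succ ℓ =>
      rw [hg.kOcc_add_three]
      exact Finset.sum_eq_zero fun i _ => Finset.sum_eq_zero fun s _ => (h i s).2 ℓ j a ha

lemma IsForest.kWeight_eq (hg : IsForest g) (p : TupleSeq k PermPattern) (x y : TupleSeq k R) :
    kWeight k p x y (forestWord g) =
      x.head ^ {i : Fin p.head.len → Fin m | p.head.IsOcc (fun i => (g i).1) i}.ncard *
        y.head ^ m *
        ∏ i, ∏ s, kWeight k (p.shift s) (x.shift s) (y.shift s) ((g i).2 s) := by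
  have hlen : ∀ i s, ((g i).2 s).length ≤ (forestWord g).length := by
    intro i s
    obtain ⟨u, v, h, -⟩ := hg.isSegment i s
    rw [h]
    simp
    omega
  -- The whole word gets one more level than its parts: peeling off the level 2 factor leaves a
  -- product of the same length as in the weights of the words `(g i).2 s`.
  rw [kWeight_eq_prod_range p x y (Nat.le_succ (forestWord g).length), hg.kOccOne_eq,
    hg.numBlocks_one, Finset.prod_range_succ']
  congr 1
  have h : ∀ i s, kWeight k (p.shift s) (x.shift s) (y.shift s) ((g i).2 s) = _ := fun i s =>
    kWeight_eq_prod_range _ _ _ (hlen i s)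
  simp only [h]
  simp only [TupleSeq.shift, hg.kOcc_two, hg.numBlocksOfType_two, zero_add, add_assoc,
    Nat.reduceAdd, hg.kOcc_add_three, hg.numBlocksOfType_add_three]
  simp only [Finset.prod_mul_distrib, ← Finset.prod_pow_eq_pow_sum]
  rw [mul_comm]
  congr 1
  · congr 1 <;> exact Finset.prod_comm
  · congr 1 <;> exact prod_comm_pairs ..

lemma IsForest.avoidingWeight_eq (hg : IsForest g) (A : TupleSeq k (Set PermPattern))
    (p : TupleSeq k PermPattern) (x y : TupleSeq k R) :
    avoidingWeight A p x y (forestWord g) =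
      patternWeight A.head p.head x.head (fun i => (g i).1) * y.head ^ m *
        ∏ i, ∏ s, avoidingWeight (A.shift s) (p.shift s) (x.shift s) (y.shift s) ((g i).2 s) := by
  classical
  rw [avoidingWeight, patternWeight]
  by_cases h1 : ∀ a ∈ A.head, {i : Fin a.len → Fin m | a.IsOcc (fun i => (g i).1) i}.ncard = 0
  · by_cases h2 : ∀ i s, AvoidsBlockPatterns (A.shift s) ((g i).2 s)
    · rw [if_pos ((hg.avoidsBlockPatterns_iff A).2 ⟨h1, h2⟩), if_pos h1, hg.kWeight_eq]
      congr 1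
      refine Finset.prod_congr rfl fun i _ => Finset.prod_congr rfl fun s _ => ?_
      rw [avoidingWeight, if_pos (h2 i s)]
    · rw [if_neg fun h => h2 ((hg.avoidsBlockPatterns_iff A).1 h).2]
      push Not at h2
      obtain ⟨i, s, h⟩ := h2
      rw [Finset.prod_eq_zero (Finset.mem_univ i), mul_zero]
      refine Finset.prod_eq_zero (Finset.mem_univ s) ?_
      rw [avoidingWeight, if_neg h]
  · rw [if_neg h1, if_neg fun h => h1 ((hg.avoidsBlockPatterns_iff A).1 h).1]
    simp

end Weight

/-! ### Relabelling -/

section Relabel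

variable {φ : ℕ → ℕ}

lemma IsForest.map {m r : ℕ} {g : Fin m → ℕ × (Fin r → List ℕ)} (hg : IsForest g)
    (hφ : Function.Injective φ) :
    IsForest fun i => (φ (g i).1, fun s => ((g i).2 s).map φ) where
  head_inj i j h := hg.head_inj i j (hφ h)
  head_notMem i j s h := by
    obtain ⟨a, ha, h⟩ := List.mem_map.1 h
    exact hg.head_notMem i j s (hφ h ▸ ha)
  disj a i s j t h h' := by
    obtain ⟨b, hb, rfl⟩ := List.mem_map.1 h
    exact hg.disj b i s j t hb ((List.mem_map_of_injective hφ).1 h')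

/-- The factorisation over the forest gives a recursion for the weight, so invariance under
relabelling only has to be checked for the pattern weight of the heads. -/
lemma avoidingWeight_map {R : Type*} [CommRing R] {k : ℕ} (hφ : StrictMono φ) {σ : List ℕ}
    (hσ : σ ∈ words (k - 1 + 1) σ.toFinset) (A : TupleSeq k (Set PermPattern))
    (p : TupleSeq k PermPattern) (x y : TupleSeq k R) :
    avoidingWeight A p x y (σ.map φ) = avoidingWeight A p x y σ := by
  induction hn : σ.length using Nat.strong_induction_on generalizing σ A p x y with
  | _ n ih =>
  obtain ⟨m, g, hg, rfl⟩ := exists_forest σ hσ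
  rw [forestWord_map, hg.toIsForest.avoidingWeight_eq,
    (hg.toIsForest.map hφ.injective).avoidingWeight_eq]
  congr 1
  · rw [patternWeight_congr fun i j => hφ.lt_iff_lt]
  · refine Finset.prod_congr rfl fun i _ => Finset.prod_congr rfl fun s _ => ?_
    refine ih _ ?_ (hg.mem_words i s) _ _ _ _ rfl
    rw [← hn]
    refine lt_of_lt_of_le ?_ ((hg.isSegment_block i).elim fun u ⟨v, h, _⟩ => by
      rw [h]; simp; omega : (blockWord (g i).1 (g i).2).length ≤ _)
    rw [blockWord_eq _ _ s]
    simp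
    omega

lemma mem_words_map {k : ℕ} (hφ : StrictMono φ) {S T : Finset ℕ} (hT : ∀ a, φ a ∈ T ↔ a ∈ S)
    (hT' : ∀ b ∈ T, b ∈ Set.range φ) {σ : List ℕ} : σ.map φ ∈ words k T ↔ σ ∈ words k S := by
  rw [mem_words, mem_words]
  refine and_congr ⟨fun h a => ?_, fun h b => ?_⟩ ⟨fun h i x hs => ?_, fun h i x hs => ?_⟩
  · rw [← List.count_map_of_injective _ _ hφ.injective, h, if_congr (hT a) rfl rfl]
  · by_cases hb : b ∈ Set.range φ
    · obtain ⟨a, rfl⟩ := hb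
      rw [List.count_map_of_injective _ _ hφ.injective, h, if_congr (hT a) rfl rfl]
    · rw [if_neg fun h => hb (hT' b h), List.count_eq_zero]
      intro h
      obtain ⟨a, -, rfl⟩ := List.mem_map.1 h
      exact hb ⟨a, rfl⟩
  · exact hφ.le_iff_le.1 (h _ _ (hs.map φ))
  · obtain ⟨l, hl, h'⟩ := List.sublist_map_iff.1 hs
    obtain ⟨a, b, c, rfl⟩ := List.length_eq_three.1
      (show l.length = 3 by simpa using (congrArg List.length h').symm)
    simp only [List.map_cons, List.map_nil, List.cons.injEq, and_true] at h'
    obtain ⟨rfl, rfl, hac⟩ := h'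
    obtain rfl := hφ.injective hac
    exact hφ.monotone (h _ _ hl)

lemma exists_strictMono_range (S : Finset ℕ) :
    ∃ φ : ℕ → ℕ, StrictMono φ ∧ (∀ a, φ a ∈ S ↔ a ∈ Finset.range S.card) ∧
      ∀ b ∈ S, b ∈ Set.range φ := by
  have hsup : ∀ b ∈ S, b ≤ S.sup id := fun b hb => Finset.le_sup (f := id) hb
  let e := S.orderEmbOfFin rfl
  have he : ∀ i, e i ∈ S := S.orderEmbOfFin_mem rfl
  -- Beyond `S.card` the values are chosen above all elements of `S`, so that the map is strictly
  -- increasing on all of `ℕ` and no further value hits `S`.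
  refine ⟨fun i => if h : i < S.card then e ⟨i, h⟩ else S.sup id + i + 1, ?_, ?_, ?_⟩
  · intro i j hij
    simp only
    split_ifs with hi hj hj
    · exact e.strictMono hij
    · have := hsup _ (he ⟨i, hi⟩)
      omega
    · omega
    · omega
  · intro a
    simp only [Finset.mem_range]
    split_ifs with h
    · simp [h, he]
    · simp only [h, iff_false]
      intro hm
      have := hsup _ hm
      omega
  · intro b hb
    have : b ∈ Set.range e := by
      rw [Finset.range_orderEmbOfFin]
      exact hb
    obtain ⟨i, rfl⟩ := this
    exact ⟨i, by simp [i.2]⟩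

lemma sum_words_map {R : Type*} [CommRing R] {k : ℕ} (hφ : StrictMono φ) {S T : Finset ℕ}
    (hT : ∀ a, φ a ∈ T ↔ a ∈ S) (hT' : ∀ b ∈ T, b ∈ Set.range φ)
    (A : TupleSeq k (Set PermPattern)) (p : TupleSeq k PermPattern) (x y : TupleSeq k R) :
    ∑ σ ∈ words (k - 1 + 1) S, avoidingWeight A p x y σ =
      ∑ σ ∈ words (k - 1 + 1) T, avoidingWeight A p x y σ := by
  refine Finset.sum_nbij (List.map φ) (fun σ hσ => (mem_words_map hφ hT hT').2 hσ)
    (hφ.injective.list_map.injOn) (fun σ hσ => ?_) fun σ hσ => ?_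
  · have : σ ∈ Set.range (List.map φ) := by
      rw [Set.range_list_map]
      intro b hb
      rw [← List.mem_toFinset, toFinset_of_mem_words (Nat.le_add_left 1 _) hσ] at hb
      exact hT' b hb
    obtain ⟨τ, rfl⟩ := this
    exact ⟨τ, (mem_words_map hφ hT hT').1 hσ, rfl⟩
  · have h := toFinset_of_mem_words (Nat.le_add_left 1 _) hσ
    exact (avoidingWeight_map hφ (h ▸ hσ) A p x y).symm

lemma sum_words_eq_of_card_eq {R : Type*} [CommRing R] {k : ℕ} {S T : Finset ℕ}
    (h : S.card = T.card)
    (A : TupleSeq k (Set PermPattern)) (p : TupleSeq k PermPattern) (x y : TupleSeq k R) :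
    ∑ σ ∈ words (k - 1 + 1) S, avoidingWeight A p x y σ =
      ∑ σ ∈ words (k - 1 + 1) T, avoidingWeight A p x y σ := by
  obtain ⟨φ, hφ, h1, h2⟩ := exists_strictMono_range S
  obtain ⟨ψ, hψ, h3, h4⟩ := exists_strictMono_range T
  rw [← sum_words_map hφ h1 h2, ← sum_words_map hψ h3 h4, h]

end Relabel

/-! ### The empty word -/

lemma patternWeight_zero {R : Type*} [CommRing R] (A : Set PermPattern) (p : PermPattern) (z : R)
    (b : Fin 0 → ℕ) :
    patternWeight A p z b = 1 := by
  have h : ∀ q : PermPattern, {i : Fin q.len → Fin 0 | q.IsOcc b i}.ncard = 0 := by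
    intro q
    refine (congrArg Set.ncard (Set.eq_empty_of_forall_notMem fun i hi => ?_)).trans
      (Set.ncard_empty _)
    exact (i ⟨0, hi.1⟩).elim0
  rw [patternWeight, if_pos fun a _ => h a, h, pow_zero]

lemma isForest_of_isEmpty {r : ℕ} (g : Fin 0 → ℕ × (Fin r → List ℕ)) : IsForest g :=
  ⟨fun i => i.elim0, fun i => i.elim0, fun _ i => i.elim0⟩

lemma avoidingWeight_nil {R : Type*} [CommRing R] {k : ℕ} (A : TupleSeq k (Set PermPattern))
    (p : TupleSeq k PermPattern) (x y : TupleSeq k R) : avoidingWeight A p x y [] = 1 := by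
  have h : ([] : List ℕ) = forestWord (Fin.elim0 : Fin 0 → ℕ × (Fin (k - 1) → List ℕ)) := by
    simp [forestWord, concatFn_zero]
  rw [h, (isForest_of_isEmpty _).avoidingWeight_eq, patternWeight_zero]
  simp

lemma words_empty (k : ℕ) : words k ∅ = {[]} := by
  ext σ
  rw [mem_words, Finset.mem_singleton]
  constructor
  · rintro ⟨h, -⟩
    exact List.eq_nil_iff_forall_not_mem.2 fun a => List.count_eq_zero.1 (by simpa using h a)
  · rintro rfl
    exact ⟨by simp, fun i x h => by simp at h⟩

/-! ### Coefficients of the generating functions -/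

section Coeff

variable {R : Type*} [CommRing R] [Algebra ℚ R]

lemma algebraMap_inv_mul_cast {n : ℕ} (hn : n ≠ 0) :
    algebraMap ℚ R (1 / (n : ℚ)) * (n : R) = 1 := by
  rw [← map_natCast (algebraMap ℚ R) n, ← map_mul, one_div_mul_cancel (by exact_mod_cast hn),
    map_one]

lemma coeff_eq_egfCoeff (G : R⟦X⟧) (n : ℕ) :
    PowerSeries.coeff n G = algebraMap ℚ R (1 / (n.factorial : ℚ)) * egfCoeff G n := by
  rw [egfCoeff, ← mul_assoc, algebraMap_inv_mul_cast n.factorial_ne_zero, one_mul]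

lemma egfCoeff_eq {G : R⟦X⟧} {n : ℕ} {c : R}
    (h : PowerSeries.coeff n G = algebraMap ℚ R (1 / (n.factorial : ℚ)) * c) :
    egfCoeff G n = c := by
  rw [egfCoeff, h, ← mul_assoc, mul_comm (n.factorial : R),
    algebraMap_inv_mul_cast n.factorial_ne_zero, one_mul]

/-- The constant term 1 is not exceptional: the empty permutation avoids everything and has weight
1. -/
lemma coeff_permEGF (A : Set PermPattern) (p : PermPattern) (z : R) (n : ℕ) :
    PowerSeries.coeff n (permEGF A p z) = algebraMap ℚ R (1 / (n.factorial : ℚ)) *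
      ∑ π ∈ avoidingPerms A n, z ^ p.occ π := by
  rw [permEGF, PowerSeries.coeff_mk]
  split_ifs with h
  · subst h
    rw [← sum_patternWeight_perm]
    simp [patternWeight_zero]
  · rfl

/-- Allowing an arbitrary label set `S` instead of `1, …, n` is what lets the series be used for the
parts of a partition. -/
lemma egfCoeff_kStirlingEGF {k : ℕ} (hk : 1 ≤ k) (A : TupleSeq k (Set PermPattern))
    (p : TupleSeq k PermPattern) (x y : TupleSeq k R) (S : Finset ℕ) :
    egfCoeff (kStirlingEGF k A p x y) S.card =
      ∑ σ ∈ words (k - 1 + 1) S, avoidingWeight A p x y σ := by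
  rw [sum_words_eq_of_card_eq (T := Finset.Icc 1 S.card) (by simp)]
  generalize S.card = n
  refine egfCoeff_eq ?_
  rw [kStirlingEGF, PowerSeries.coeff_mk, Nat.sub_add_cancel hk]
  split_ifs with h
  · subst h
    simp [words_empty, avoidingWeight_nil]
  · congr 1
    unfold kStirlingAvoiding
    rw [Finset.sum_filter, kStirling_eq_words]
    refine Finset.sum_congr rfl fun σ _ => ?_
    rw [avoidingWeight]
    by_cases hA : AvoidsBlockPatterns A σ
    · exact (if_pos hA).trans (if_pos hA).symm
    · exact (if_neg hA).trans (if_neg hA).symm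

lemma egfCoeff_formalIntegral_zero (f : R⟦X⟧) : egfCoeff (formalIntegral f) 0 = 0 := by
  simp [egfCoeff, formalIntegral]

/-- Integration shifts the sequence by one; combinatorially it adds a label whose place is forced,
here the least letter of a block. -/
lemma egfCoeff_formalIntegral_succ (f : R⟦X⟧) (n : ℕ) :
    egfCoeff (formalIntegral f) (n + 1) = egfCoeff f n := by
  have := algebraMap_inv_mul_cast (R := R) n.succ_ne_zero
  rw [egfCoeff, formalIntegral, PowerSeries.coeff_mk, if_neg n.succ_ne_zero, egfCoeff,
    Nat.factorial_succ, Nat.cast_mul, Nat.add_sub_cancel]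
  linear_combination (n.factorial : R) * PowerSeries.coeff n f * this

end Coeff

/-! ### Decomposition of the words on a given set of letters -/

/-- The pairs `(b, w)` such that `blockWord b w` is a word on `T` with a single level 1 block. -/
noncomputable def blockStructures (r : ℕ) (T : Finset ℕ) : Finset (ℕ × (Fin r → List ℕ)) :=
  if h : T.Nonempty then
    (families (fun _ U => words (r + 1) U) (T.erase (T.min' h))).map
      ⟨fun w => (T.min' h, w), Prod.mk_right_injective _⟩
  else ∅

lemma mem_families_words {r : ℕ} {S : Finset ℕ} {w : Fin r → List ℕ} :
    w ∈ families (fun _ U => words (r + 1) U) S ↔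
      (∀ s, w s ∈ words (r + 1) (w s).toFinset) ∧
        (∀ a s t, a ∈ w s → a ∈ w t → s = t) ∧ ∀ a, a ∈ S ↔ ∃ s, a ∈ w s := by
  rw [mem_families (supp := List.toFinset)
    fun _ T b hb => toFinset_of_mem_words (Nat.le_add_left 1 r) hb]
  simp only [List.mem_toFinset, Finset.disjoint_left]
  refine and_congr_right fun _ => and_congr_left fun _ => ⟨fun h a s t hs ht => ?_, ?_⟩
  · by_contra hst
    exact h s t hst hs ht
  · exact fun h s t hst a hs ht => hst (h a s t hs ht)

/-- Since the head is smaller than all other letters of its block, it must be the minimum of `T`. -/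
lemma mem_blockStructures {r : ℕ} {T : Finset ℕ} {q : ℕ × (Fin r → List ℕ)} :
    q ∈ blockStructures r T ↔ (∀ s, q.2 s ∈ words (r + 1) (q.2 s).toFinset) ∧
      (∀ a s t, a ∈ q.2 s → a ∈ q.2 t → s = t) ∧ (∀ s, ∀ a ∈ q.2 s, q.1 < a) ∧
        (blockWord q.1 q.2).toFinset = T := by
  constructor
  · intro hq
    rw [blockStructures] at hq
    split_ifs at hq with h
    · rw [Finset.mem_map] at hq
      obtain ⟨w, hw, rfl⟩ := hq
      obtain ⟨h1, h2, h3⟩ := mem_families_words.1 hw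
      refine ⟨h1, h2, fun s a ha => ?_, ?_⟩
      · exact T.min'_lt_of_mem_erase_min' h ((h3 a).2 ⟨s, ha⟩)
      · ext a
        rw [List.mem_toFinset, mem_blockWord]
        simp only [Function.Embedding.coeFn_mk]
        rw [← h3, Finset.mem_erase]
        by_cases ha : a = T.min' h
        · simp [ha, T.min'_mem h]
        · simp [ha]
    · simp at hq
  · rintro ⟨h1, h2, h3, rfl⟩
    have hmem : q.1 ∈ (blockWord q.1 q.2).toFinset := by simp [mem_blockWord]
    have h : (blockWord q.1 q.2).toFinset.Nonempty := ⟨_, hmem⟩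
    have hmin : (blockWord q.1 q.2).toFinset.min' h = q.1 := by
      refine le_antisymm (Finset.min'_le _ _ hmem) (Finset.le_min' _ _ _ fun a ha => ?_)
      rw [List.mem_toFinset, mem_blockWord] at ha
      rcases ha with rfl | ⟨s, hs⟩
      · exact le_rfl
      · exact (h3 s a hs).le
    rw [blockStructures, dif_pos h, Finset.mem_map]
    refine ⟨q.2, mem_families_words.2 ⟨h1, h2, fun a => ?_⟩, Prod.ext hmin rfl⟩
    rw [hmin, Finset.mem_erase, List.mem_toFinset, mem_blockWord]
    constructor
    · rintro ⟨ha, h⟩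
      exact h.resolve_left ha
    · rintro ⟨s, hs⟩
      exact ⟨(h3 s a hs).ne', .inr ⟨s, hs⟩⟩

lemma mem_families_blockStructures {m r : ℕ} {S : Finset ℕ} {g : Fin m → ℕ × (Fin r → List ℕ)} :
    g ∈ families (fun _ => blockStructures r) S ↔
      IsStirlingForest g ∧ ∀ a, a ∈ S ↔ a ∈ forestWord g := by
  rw [mem_families (supp := fun q => (blockWord q.1 q.2).toFinset)
    fun _ T q hq => (mem_blockStructures.1 hq).2.2.2]
  simp only [mem_blockStructures, and_true, List.mem_toFinset, Finset.disjoint_left]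
  rw [← and_assoc]
  refine and_congr ?_ (by simp only [forestWord, mem_concatFn])
  constructor
  · rintro ⟨h1, h2⟩
    have hd : ∀ i j a, a ∈ blockWord (g i).1 (g i).2 → a ∈ blockWord (g j).1 (g j).2 → i = j := by
      intro i j a hi hj
      by_contra h
      exact h2 i j h hi hj
    refine ⟨⟨fun i j h => ?_, fun i j s h => ?_, fun a i s j t hi hj => ?_⟩,
      fun i => (h1 i).2.2, fun i => (h1 i).1⟩
    · exact hd i j (g i).1 (mem_blockWord.2 (.inl rfl)) (mem_blockWord.2 (.inl h))
    · obtain rfl := hd i j (g i).1 (mem_blockWord.2 (.inl rfl)) (mem_blockWord.2 (.inr ⟨s, h⟩))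
      exact lt_irrefl _ ((h1 i).2.2 s _ h)
    · obtain rfl := hd i j a (mem_blockWord.2 (.inr ⟨s, hi⟩)) (mem_blockWord.2 (.inr ⟨t, hj⟩))
      exact ⟨rfl, (h1 i).2.1 a s t hi hj⟩
  · intro h
    exact ⟨fun i => ⟨h.mem_words i, fun a s t hs ht => (h.disj a i s i t hs ht).2, h.head_lt i⟩,
      fun i j hij a hi hj => hij (h.eq_of_mem_blockWord hi hj)⟩

lemma sum_words_eq_sum_families {R : Type*} [CommRing R] {r : ℕ} (S : Finset ℕ)
    (W : List ℕ → R) :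
    ∑ σ ∈ words (r + 1) S, W σ = ∑ m ∈ Finset.range (S.card + 1),
      ∑ g ∈ families (fun _ : Fin m => blockStructures r) S, W (forestWord g) := by
  rw [Finset.sum_sigma']
  symm
  refine Finset.sum_nbij (fun x => forestWord x.2) (fun x hx => ?_) (fun x hx x' hx' h => ?_)
    (fun σ hσ => ?_) fun x hx => rfl
  · obtain ⟨h1, h2⟩ := mem_families_blockStructures.1 (Finset.mem_sigma.1 hx).2
    have : S = (forestWord x.2).toFinset := by ext a; rw [h2, List.mem_toFinset]
    rw [this]
    exact forestWord_mem_words h1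
  · have h1 := (mem_families_blockStructures.1 (Finset.mem_sigma.1 hx).2).1
    have h2 := (mem_families_blockStructures.1 (Finset.mem_sigma.1 hx').2).1
    exact List.ofFn_inj'.1 (forestWord_inj h1.toIsForest h2.toIsForest h)
  · have hS := toFinset_of_mem_words (Nat.le_add_left 1 r) hσ
    obtain ⟨m, g, hg, rfl⟩ := exists_forest σ (by rw [hS]; exact hσ)
    refine ⟨⟨m, g⟩, Finset.mem_coe.2 (Finset.mem_sigma.2 ⟨?_, ?_⟩), rfl⟩
    -- The heads are distinct letters, so there are at most `S.card` blocks.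
    · rw [Finset.mem_range, Nat.lt_succ_iff, ← hS]
      refine le_trans (by simp) (Finset.card_le_card_of_injOn (s := Finset.univ)
        (fun i => (g i).1) (fun i _ => ?_) fun i _ j _ h => hg.head_inj i j h)
      exact List.mem_toFinset.2 (IsForest.head_mem g i)
    · exact mem_families_blockStructures.2 ⟨hg, fun a => by rw [← hS, List.mem_toFinset]⟩

/-! ### Symmetrization over the heads and the functional equation -/

section Main

variable {R : Type*} [CommRing R]

/-- Permuting the blocks is a bijection on families that leaves the product of the `v (g i)`
unchanged. Summing over all `m!` permutations turns the pattern weight of the distinct heads into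
the full sum over permutations of length `m`, whatever the heads are. -/
lemma sum_families_patternWeight {m r : ℕ} (S : Finset ℕ) (A : Set PermPattern) (p : PermPattern)
    (z : R) (v : ℕ × (Fin r → List ℕ) → R) :
    (m.factorial : R) * ∑ g ∈ families (fun _ : Fin m => blockStructures r) S,
        patternWeight A p z (fun i => (g i).1) * ∏ i, v (g i) =
      (∑ π ∈ avoidingPerms A m, z ^ p.occ π) *
        ∑ g ∈ families (fun _ : Fin m => blockStructures r) S, ∏ i, v (g i) := by
  have hperm : ∀ ρ : Equiv.Perm (Fin m), ∑ g ∈ families (fun _ : Fin m => blockStructures r) S,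
        patternWeight A p z (fun i => (g i).1) * ∏ i, v (g i) =
      ∑ g ∈ families (fun _ : Fin m => blockStructures r) S,
        patternWeight A p z ((fun i => (g i).1) ∘ ρ) * ∏ i, v (g i) := by
    intro ρ
    symm
    have hmem : ∀ (ρ : Equiv.Perm (Fin m)), ∀ g ∈ families (fun _ : Fin m => blockStructures r) S,
        g ∘ ρ ∈ families (fun _ : Fin m => blockStructures r) S := by
      intro ρ g hg
      obtain ⟨h1, h2⟩ := mem_families_blockStructures.1 hg
      refine mem_families_blockStructures.2 ⟨⟨⟨fun i j h => ?_, fun i j s => ?_,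
        fun a i s j t h h' => ?_⟩, fun i => h1.head_lt _, fun i => h1.mem_words _⟩, fun a => ?_⟩
      · exact ρ.injective (h1.head_inj _ _ h)
      · exact h1.head_notMem _ _ _
      · have := h1.disj a _ s _ t h h'
        exact ⟨ρ.injective this.1, this.2⟩
      · rw [h2, mem_forestWord, mem_forestWord]
        exact ⟨fun ⟨i, h⟩ => ⟨ρ.symm i, by simpa using h⟩, fun ⟨i, h⟩ => ⟨ρ i, h⟩⟩
    refine Finset.sum_nbij' (fun g => g ∘ ρ) (fun g => g ∘ ρ.symm) (hmem ρ) (hmem ρ.symm)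
      (fun g _ => ?_) (fun g _ => ?_) fun g _ => ?_
    · funext i; simp
    · funext i; simp
    · congr 1
      exact (Equiv.prod_comp ρ fun i => v (g i)).symm
  have hsum := Finset.sum_congr rfl
    fun (ρ : Equiv.Perm (Fin m)) (_ : ρ ∈ Finset.univ) => hperm ρ
  rw [Finset.sum_const, Finset.card_univ, Fintype.card_perm, Fintype.card_fin, nsmul_eq_mul] at hsum
  rw [hsum, Finset.sum_comm, Finset.mul_sum]
  refine Finset.sum_congr rfl fun g hg => ?_
  have hinj : Function.Injective fun i => (g i).1 := fun i j =>
    (mem_families_blockStructures.1 hg).1.head_inj i j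
  rw [← Finset.sum_mul, sum_patternWeight_comp hinj]

variable [Algebra ℚ R]

lemma sum_blockStructures {k : ℕ} (hk : 1 ≤ k) (A : TupleSeq k (Set PermPattern))
    (p : TupleSeq k PermPattern) (x y : TupleSeq k R) (T : Finset ℕ) :
    ∑ q ∈ blockStructures (k - 1) T,
        ∏ s, avoidingWeight (A.shift s) (p.shift s) (x.shift s) (y.shift s) (q.2 s) =
      egfCoeff (formalIntegral (∏ s, kStirlingEGF k (A.shift s) (p.shift s) (x.shift s)
        (y.shift s))) T.card := by
  rw [blockStructures]
  split_ifs with h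
  · rw [Finset.sum_map]
    simp only [Function.Embedding.coeFn_mk]
    rw [sum_families (supp := List.toFinset)
      (fun _ T b hb => toFinset_of_mem_words (Nat.le_add_left 1 _) hb)
      (fun s => avoidingWeight (A.shift s) (p.shift s) (x.shift s) (y.shift s)) _
      (fun s T => (egfCoeff_kStirlingEGF hk _ _ _ _ T).symm),
      ← Finset.card_erase_add_one (T.min'_mem h), egfCoeff_formalIntegral_succ]
  · rw [Finset.not_nonempty_iff_eq_empty.1 h]
    simp [egfCoeff_formalIntegral_zero]

theorem kStirlingEGF_eq_subst {k : ℕ} (hk : 1 ≤ k) (A : TupleSeq k (Set PermPattern))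
    (p : TupleSeq k PermPattern) (x y : TupleSeq k R) :
    kStirlingEGF k A p x y =
      (permEGF A.head p.head x.head).subst
        (PowerSeries.C y.head * formalIntegral
          (∏ j : Fin (k - 1),
            kStirlingEGF k (A.shift j) (p.shift j) (x.shift j) (y.shift j))) := by
  set H := formalIntegral (∏ j : Fin (k - 1),
    kStirlingEGF k (A.shift j) (p.shift j) (x.shift j) (y.shift j)) with hH
  ext n
  -- The inner series has no constant term, so only powers `m ≤ n` contribute; they match the
  -- forests with `m` blocks.
  rw [coeff_subst_eq_sum (by simp [hH, formalIntegral]) (Nat.lt_succ_self n), coeff_eq_egfCoeff]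
  have hn : (Finset.range n).card = n := Finset.card_range n
  have h1 := egfCoeff_kStirlingEGF hk A p x y (Finset.range n)
  rw [sum_words_eq_sum_families, hn] at h1
  rw [h1, Finset.mul_sum]
  refine Finset.sum_congr rfl fun m _ => ?_
  have h2 : ∀ g ∈ families (fun _ : Fin m => blockStructures (k - 1)) (Finset.range n),
      avoidingWeight A p x y (forestWord g) =
        y.head ^ m * (patternWeight A.head p.head x.head (fun i => (g i).1) *
          ∏ i, (fun q : ℕ × (Fin (k - 1) → List ℕ) => ∏ s, avoidingWeight (A.shift s) (p.shift s)
            (x.shift s) (y.shift s) (q.2 s)) (g i)) := by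
    intro g hg
    rw [(mem_families_blockStructures.1 hg).1.toIsForest.avoidingWeight_eq]
    ring
  have h3 := sum_families (C := fun _ : Fin m => blockStructures (k - 1))
    (supp := fun q => (blockWord q.1 q.2).toFinset)
    (fun _ T q hq => (mem_blockStructures.1 hq).2.2.2)
    (fun _ q => ∏ s, avoidingWeight (A.shift s) (p.shift s)
            (x.shift s) (y.shift s) (q.2 s)) (fun _ => H)
    (fun _ T => sum_blockStructures hk A p x y T) (Finset.range n)
  rw [hn, Finset.prod_const, Finset.card_univ, Fintype.card_fin] at h3
  rw [Finset.sum_congr rfl h2, ← Finset.mul_sum, coeff_permEGF, mul_pow, ← map_pow,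
    PowerSeries.coeff_C_mul, coeff_eq_egfCoeff (H ^ m), ← h3]
  have h4 := sum_families_patternWeight (m := m) (Finset.range n) A.head p.head x.head
    (fun q : ℕ × (Fin (k - 1) → List ℕ) => ∏ s, avoidingWeight (A.shift s) (p.shift s)
            (x.shift s) (y.shift s) (q.2 s))
  have h5 := algebraMap_inv_mul_cast (R := R) m.factorial_ne_zero
  simp only at h4 ⊢
  -- The `m!` from the symmetrization cancels against the `1 / m!` in the coefficient of `F`.
  linear_combination (algebraMap ℚ R (1 / (n.factorial : ℚ))) * y.head ^ m *
    (algebraMap ℚ R (1 / (m.factorial : ℚ))) * h4 - (algebraMap ℚ R (1 / (n.factorial : ℚ))) *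
      y.head ^ m * (∑ g ∈ families (fun _ : Fin m => blockStructures (k - 1)) (Finset.range n),
        patternWeight A.head p.head x.head (fun i => (g i).1) *
          ∏ i, ∏ s, avoidingWeight (A.shift s) (p.shift s)
            (x.shift s) (y.shift s) ((g i).2 s)) * h5

end Main

/-! ### Stirling permutations -/

section Two

variable {n : ℕ} {σ : List ℕ}

/-- The two occurrences of `h` are the ends of its block, and all of `a` lies strictly between them.
Hence type 1 is the only type when `k = 2`. -/
lemma BlockSub.count_takeWhile_eq_one (hσ : σ ∈ kStirling 2 n) {a h : ℕ} (hs : BlockSub σ a h) :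
    (σ.takeWhile (· ≠ a)).count h = 1 := by
  rw [kStirling_eq_words] at hσ
  have hh := hs.right_mem
  obtain ⟨u, v, hσ', hu, hv, h₁, h₂⟩ := exists_block hh
  have hcount : σ.count h = 2 := by
    rw [(mem_words.1 hσ).1, if_pos]
    rw [← toFinset_of_mem_words one_le_two hσ]
    exact List.mem_toFinset.2 hh
  -- The block of `h` contains all occurrences of `a`, so none precedes that block.
  have hcount_a : σ.count a ≤ (block σ h).count a := by
    obtain ⟨u', v', h', hu', hv', -⟩ := exists_block hs.1
    have hc := congrArg (List.count a) h'
    rw [List.count_append, List.count_append, List.count_eq_zero_of_not_mem hu',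
      List.count_eq_zero_of_not_mem hv', zero_add, add_zero] at hc
    rw [hc]
    exact hs.2.2.sublist.count_le a
  have hmem := hs.mem_block
  have hne := hs.2.1
  -- Detaching the block from `σ` allows `σ` to be replaced by its factorisation around `B`.
  generalize block σ h = B at *
  subst hσ'
  have hau : a ∉ u := by
    rw [List.count_append, List.count_append] at hcount_a
    exact List.count_eq_zero.1 (by omega)
  obtain ⟨B', rfl⟩ : ∃ B', B = h :: B' := by
    cases B with
    | nil => simp at h₁
    | cons b B' => simp at h₁; exact ⟨B', by rw [h₁]⟩
  obtain ⟨x, y, rfl, hx⟩ := List.eq_append_cons_of_mem ((List.mem_cons.1 hmem).resolve_left hne)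
  have hy : h ∈ y := by
    rw [← List.cons_append, List.getLast?_append] at h₂
    have : (a :: y).getLast? = some h := by simpa using h₂
    exact (List.mem_cons.1 (List.mem_of_getLast? this)).resolve_left hne.symm
  have hy := List.count_pos_iff.2 hy
  simp only [List.count_append, List.count_cons_self, List.count_cons_of_ne hne,
    List.count_eq_zero_of_not_mem hu, List.count_eq_zero_of_not_mem hv] at hcount
  have hx' : a ∉ h :: x := by simp [hne, hx]
  rw [← List.cons_append, List.append_assoc, List.append_assoc,
    List.takeWhile_append_of_pos (decide_ne_of_notMem hau),
    List.takeWhile_append_of_pos (decide_ne_of_notMem hx'), List.count_append, List.count_append,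
    List.count_cons_self, List.count_eq_zero_of_not_mem hu]
  simp
  omega

lemma IsLevel.hasType_one (hσ : σ ∈ kStirling 2 n) {a ℓ : ℕ} (h : IsLevel σ (ℓ + 2) a) :
    HasType σ a 1 := by
  obtain ⟨b, hb, hl, hs, h1⟩ := id h
  exact ⟨b, ⟨hs, _, hl, h⟩, hs.count_takeWhile_eq_one hσ⟩

lemma numBlocksOfType_eq_numBlocks (hσ : σ ∈ kStirling 2 n) (ℓ : ℕ) :
    numBlocksOfType σ (ℓ + 2) 1 = numBlocks σ (ℓ + 2) := by
  refine congrArg Set.ncard (Set.ext fun a => ?_)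
  exact ⟨fun h => h.1, fun h => ⟨h, IsLevel.hasType_one hσ h⟩⟩

lemma isBlockOcc_congr {sib sib' : ℕ → ℕ → Prop} {p : PermPattern} {b : Fin p.len → ℕ}
    (h : ∀ a c, sib (b a) (b c) ↔ sib' (b a) (b c)) :
    IsBlockOcc sib σ p b ↔ IsBlockOcc sib' σ p b := by
  simp only [IsBlockOcc, h]

lemma kOccOne_eq_levelOcc (p : PermPattern) : kOccOne σ p = levelOcc σ 1 p := by
  refine congrArg Set.ncard (Set.ext fun b => and_congr_left fun h =>
    isBlockOcc_congr fun a c => ?_)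
  exact ⟨fun _ => .inl ⟨h a, h c⟩, fun _ => .inl ⟨h a, h c⟩⟩

/-- From level 2 on every block has type 1, so the type conditions, including the one in the sibling
relation, hold automatically. -/
lemma kOcc_eq_levelOcc (hσ : σ ∈ kStirling 2 n) (ℓ : ℕ) (p : PermPattern) :
    kOcc σ (ℓ + 2) 1 p = levelOcc σ (ℓ + 2) p := by
  refine congrArg Set.ncard (Set.ext fun b => ?_)
  have hl : (∀ a, IsLevel σ (ℓ + 2) (b a) ∧ HasType σ (b a) 1) ↔ ∀ a, IsLevel σ (ℓ + 2) (b a) :=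
    forall_congr' fun a => ⟨fun h => h.1, fun h => ⟨h, h.hasType_one hσ⟩⟩
  rw [Set.mem_ofPred_eq, Set.mem_ofPred_eq, hl]
  refine and_congr_left fun h => isBlockOcc_congr fun a c => ?_
  refine or_congr_right ⟨fun h => h.1, fun h' => ⟨h', 1, ?_, ?_⟩⟩
  · exact (h a).hasType_one hσ
  · exact (h c).hasType_one hσ

lemma levelOcc_eq_zero {ℓ : ℕ} {p : PermPattern} (h : σ.length < ℓ) : levelOcc σ ℓ p = 0 := by
  refine (congrArg Set.ncard (Set.eq_empty_of_forall_notMem fun b hb => ?_)).trans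
    (Set.ncard_empty _)
  exact not_isLevel_of_length_lt h (hb.2 ⟨0, hb.1.1⟩)

lemma numBlocks_eq_zero {ℓ : ℕ} (h : σ.length < ℓ) : numBlocks σ ℓ = 0 := by
  refine (congrArg Set.ncard (Set.eq_empty_of_forall_notMem fun a ha => ?_)).trans
    (Set.ncard_empty _)
  exact not_isLevel_of_length_lt h ha

lemma mem_kStirlingAvoiding {k : ℕ} {A : TupleSeq k (Set PermPattern)} :
    σ ∈ kStirlingAvoiding k n A ↔ σ ∈ kStirling k n ∧ AvoidsBlockPatterns A σ := by
  unfold kStirlingAvoiding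
  exact @Finset.mem_filter _ _ (_) _ _

lemma mem_stirlingAvoiding {A : ℕ → Set PermPattern} :
    σ ∈ stirlingAvoiding n A ↔
      σ ∈ kStirling 2 n ∧ ∀ i : ℕ, ∀ a ∈ A i, levelOcc σ (i + 1) a = 0 := by
  unfold stirlingAvoiding
  exact @Finset.mem_filter _ _ (_) _ _

lemma stirlingAvoiding_eq (A : ℕ → Set PermPattern) :
    stirlingAvoiding n A = kStirlingAvoiding 2 n (TupleSeq.ofSeq A) := by
  ext σ
  rw [mem_stirlingAvoiding, mem_kStirlingAvoiding]
  refine and_congr_right fun hσ => ?_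
  refine ⟨fun h => ⟨fun a ha => ?_, fun i j a ha => ?_⟩, fun h i a ha => ?_⟩
  · rw [kOccOne_eq_levelOcc]
    exact h 0 a ha
  · obtain rfl : j = ⟨0, Nat.one_pos⟩ := Fin.ext (by have := j.2; omega)
    rw [zero_add, kOcc_eq_levelOcc hσ]
    exact h (i + 1) a ha
  · cases i with
    | zero =>
      rw [zero_add, ← kOccOne_eq_levelOcc]
      exact h.1 a ha
    | succ i =>
      rw [← kOcc_eq_levelOcc hσ]
      exact h.2 i ⟨0, Nat.one_pos⟩ a ha

lemma kWeight_ofSeq {R : Type*} [CommRing R] (hσ : σ ∈ kStirling 2 n) (p : ℕ → PermPattern)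
    (x y : ℕ → R) :
    kWeight 2 (TupleSeq.ofSeq p) (TupleSeq.ofSeq x) (TupleSeq.ofSeq y) σ =
      ∏ᶠ i : ℕ, x i ^ levelOcc σ (i + 1) (p i) * y i ^ numBlocks σ (i + 1) := by
  -- Level 1 is a separate factor of `kWeight` but the index `0` factor of the product on the right,
  -- which therefore runs over one more index.
  rw [kWeight_eq_prod_range _ _ _ le_rfl,
    finprod_eq_prod_of_mulSupport_subset (s := Finset.range (σ.length + 1)),
    Finset.prod_range_succ', mul_comm]
  · refine congrArg₂ _ (Finset.prod_congr rfl fun i _ => ?_) ?_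
    · rw [← kOcc_eq_levelOcc hσ, ← numBlocksOfType_eq_numBlocks hσ]
      exact Fintype.prod_unique (ι := Fin 1) _
    · rw [kOccOne_eq_levelOcc]
      rfl
  · intro i hi
    simp only [Finset.coe_range, Set.mem_Iio]
    by_contra hle
    refine hi ?_
    simp only
    rw [levelOcc_eq_zero (by omega), numBlocks_eq_zero (by omega)]
    simp

lemma stirlingEGF_eq_kStirlingEGF {R : Type*} [CommRing R] [Algebra ℚ R]
    (A : ℕ → Set PermPattern) (p : ℕ → PermPattern) (x y : ℕ → R) :
    stirlingEGF A p x y = kStirlingEGF 2 (TupleSeq.ofSeq A) (TupleSeq.ofSeq p)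
      (TupleSeq.ofSeq x) (TupleSeq.ofSeq y) := by
  ext n
  rw [stirlingEGF, kStirlingEGF, PowerSeries.coeff_mk, PowerSeries.coeff_mk, stirlingAvoiding_eq]
  congr 2
  refine Finset.sum_congr rfl fun σ hσ => (kWeight_ofSeq (n := n) ?_ p x y).symm
  exact (mem_kStirlingAvoiding.1 hσ).1

end Two

theorem theorem4 {R : Type*} [CommRing R] [Algebra ℚ R] :
    (∀ (k : ℕ) (_ : 1 ≤ k) (A : TupleSeq k (Set PermPattern)) (p : TupleSeq k PermPattern)
        (x y : TupleSeq k R),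
      kStirlingEGF k A p x y =
        (permEGF A.head p.head x.head).subst
          (PowerSeries.C y.head * formalIntegral
            (∏ j : Fin (k - 1),
              kStirlingEGF k (A.shift j) (p.shift j) (x.shift j) (y.shift j)))) ∧
    (∀ (A : ℕ → Set PermPattern) (p : ℕ → PermPattern) (x y : ℕ → R),
      stirlingEGF A p x y =
          kStirlingEGF 2 (TupleSeq.ofSeq A) (TupleSeq.ofSeq p)
            (TupleSeq.ofSeq x) (TupleSeq.ofSeq y) ∧
      stirlingEGF A p x y =
        (permEGF (A 0) (p 0) (x 0)).subst
          (PowerSeries.C (y 0) * formalIntegral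
            (stirlingEGF (fun i => A (i + 1)) (fun i => p (i + 1))
              (fun i => x (i + 1)) (fun i => y (i + 1))))) := by
  refine ⟨fun k hk A p x y => kStirlingEGF_eq_subst hk A p x y,
    fun A p x y => ⟨stirlingEGF_eq_kStirlingEGF A p x y, ?_⟩⟩
  rw [stirlingEGF_eq_kStirlingEGF, kStirlingEGF_eq_subst one_le_two, stirlingEGF_eq_kStirlingEGF]
  congr 3
  -- With a single type the product under the integral has one factor, and shifting an `ofSeq`
  -- sequence is `ofSeq` of the shifted sequence by definition.
  exact Fintype.prod_unique (ι := Fin 1) _
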